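/- Let $F$ be a finite field with $q$ elements and let $n\ge 0$ be an integer. Let $\mathsf m:[n]\to[n]$ be a Hessenberg function, that is, a weakly increasing function with $\mathsf m(i)\ge i$ for all $i\in[n]$, and let $T:F^n\to F^n$ be a linear operator. The set of points of the Hessenberg variety is $$\mathscr H(\mathsf m,T)=\{\text{complete flags } V_1\subseteq V_2\subseteq\cdots\subseteq V_n=F^n \ (\dim V_i=i) : TV_i\subseteq V_{\mathsf m(i)} \text{ for all } i\in[n]\}.$$ Let $G(\mathsf m)$ be the graph with vertex set $[n]$ and edge set $\{\{i,j\}: i<j\le \mathsf m(i)\}$, and let $$X_{G(\mathsf m)}(x;q)=\sum_{\kappa} q^{\mathrm{asc}(\kappa)}\,x_{\kappa(1)}x_{\kappa(2)}\cdots x_{\kappa(n)}$$ be its chromatic quasisymmetric function at $t=q$, where $\kappa$ runs over all proper vertex colorings of $G(\mathsf m)$ with colors in $\{1,2,3,\dots\}$ and $\mathrm{asc}(\kappa)$ is the number of edges $\{i,j\}$ with $i<j$ and $\kappa(i)<\kappa(j)$. Suppose that $T$ is regular semisimple, i.e. its characteristic polynomial is a product of distinct monic irreducible polynomials over $F$,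 and let $\lambda$ be the partition of $n$ whose parts are the degrees of the distinct irreducible factors of the characteristic polynomial of $T$. Then $X_{G(\mathsf m)}(x;q)$ is a symmetric function in $x_1,x_2,\dots$, and $$|\mathscr H(\mathsf m,T)|=\langle p_\lambda,\ \omega X_{G(\mathsf m)}(x;q)\rangle .$$ Here $p_\lambda$ is the power sum symmetric function, $\omega$ is the standard involution of the ring of symmetric functions over $\mathbb Q$ (the algebra automorphism with $\omega e_k=h_k$ for all $k\ge1$; it takes $s_\lambda$ to $s_{\lambda'}$), and $\langle\cdot,\cdot\rangle$ is the Hall scalar product, for which the monomial symmetric functions $m_\lambda$ and the complete homogeneous symmetric functions $h_\mu$ are dual bases. -/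

import Mathlib

/-! ### Symmetric functions in infinitely many variables

The variables `x₁, x₂, …` are indexed by `ℕ` (so `x₁` has index `0`, and so on). -/

namespace SymFun

open MvPowerSeries

variable {R : Type*} [CommRing R]

theorem coeff_embDomain_renameEquiv (e : Equiv.Perm ℕ) (f : MvPowerSeries ℕ R) (d : ℕ →₀ ℕ) :
    coeff (d.embDomain e.toEmbedding) (renameEquiv R e f) = coeff d f := by
  simpa using coeff_embDomain_rename e.toEmbedding f d

theorem renameEquiv_eq_self_iff (e : Equiv.Perm ℕ) (f : MvPowerSeries ℕ R) :
    renameEquiv R e f = f ↔ ∀ d, coeff (d.embDomain e.toEmbedding) f = coeff d f := by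
  constructor
  · intro h d
    conv_lhs => rw [← h]
    exact coeff_embDomain_renameEquiv e f d
  · intro h
    ext d
    obtain ⟨d', rfl⟩ : ∃ d' : ℕ →₀ ℕ, d'.embDomain e.toEmbedding = d :=
      ⟨d.embDomain e.symm.toEmbedding, by
        ext i
        obtain ⟨j, rfl⟩ := e.surjective i
        obtain ⟨k, rfl⟩ := e.symm.surjective j
        have h1 := Finsupp.embDomain_apply_self e.toEmbedding
          (d.embDomain e.symm.toEmbedding) (e.symm k)
        have h2 := Finsupp.embDomain_apply_self e.symm.toEmbedding d k
        simp only [Equiv.coe_toEmbedding, Equiv.apply_symm_apply] at h1 h2 ⊢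
        rw [h1, h2]⟩
    rw [coeff_embDomain_renameEquiv, h]

variable (R) in
/-- The ring of symmetric functions over `R`: formal power series in `x₁, x₂, …` of bounded
degree that are invariant under all permutations of the variables. -/
def Sym : Subalgebra R (MvPowerSeries ℕ R) where
  carrier := {f | (∀ e : Equiv.Perm ℕ, renameEquiv R e f = f) ∧
    ∃ N : ℕ, ∀ d : ℕ →₀ ℕ, N < d.degree → coeff d f = 0}
  mul_mem' := by
    rintro f g ⟨hf, N, hN⟩ ⟨hg, M, hM⟩
    refine ⟨fun e => by rw [map_mul, hf, hg], N + M, fun d hd => ?_⟩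
    rw [coeff_mul]
    refine Finset.sum_eq_zero fun p hp => ?_
    rw [Finset.HasAntidiagonal.mem_antidiagonal] at hp
    have : p.1.degree + p.2.degree = d.degree := by rw [← hp, map_add]
    rcases lt_or_ge N p.1.degree with h | h
    · rw [hN _ h, zero_mul]
    · rw [hM _ (by omega), mul_zero]
  add_mem' := by
    rintro f g ⟨hf, N, hN⟩ ⟨hg, M, hM⟩
    refine ⟨fun e => by rw [map_add, hf, hg], max N M, fun d hd => ?_⟩
    rw [map_add, hN d (by omega), hM d (by omega), add_zero]
  algebraMap_mem' r := by
    refine ⟨fun e => AlgEquiv.commutes _ r, 0, fun d hd => ?_⟩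
    have : d ≠ 0 := by rintro rfl; simp at hd
    classical
    rw [MvPowerSeries.algebraMap_apply, coeff_C, if_neg this]

theorem degree_embDomain {α β : Type*} (e : α ↪ β) (d : α →₀ ℕ) :
    (d.embDomain e).degree = d.degree := by
  rw [Finsupp.embDomain_eq_mapDomain, Finsupp.degree_mapDomain]

theorem embDomain_le_one_iff {α β : Type*} (e : α ↪ β) (d : α →₀ ℕ) :
    (∀ i, d.embDomain e i ≤ 1) ↔ ∀ i, d i ≤ 1 := by
  constructor
  · intro h i
    simpa using h (e i)
  · intro h j
    by_cases hj : j ∈ Set.range e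
    · obtain ⟨i, rfl⟩ := hj
      simpa using h i
    · rw [Finsupp.embDomain_of_notMem_range _ _ _ hj]
      exact Nat.zero_le _

/-- A homogeneous series whose coefficients are invariant under permutations of the variables
is a symmetric function. -/
theorem mem_of_invariant (f : MvPowerSeries ℕ R) (k : ℕ)
    (h : ∀ (e : Equiv.Perm ℕ) (d : ℕ →₀ ℕ), coeff (d.embDomain e.toEmbedding) f = coeff d f)
    (hk : ∀ d : ℕ →₀ ℕ, k < d.degree → coeff d f = 0) : f ∈ Sym R :=
  ⟨fun e => (renameEquiv_eq_self_iff e f).2 (h e), k, hk⟩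

open Classical in
variable (R) in
/-- The elementary symmetric function `eₖ`: the sum of all squarefree monomials of degree `k`. -/
noncomputable def e (k : ℕ) : Sym R :=
  ⟨fun d => if d.degree = k ∧ ∀ i, d i ≤ 1 then 1 else 0, by
    refine mem_of_invariant _ k (fun s d => ?_) (fun d hd => ?_)
    · change ite _ _ _ = ite _ _ _
      rw [degree_embDomain, embDomain_le_one_iff]
    · exact if_neg fun h => by omega⟩

open Classical in
variable (R) in
/-- The complete homogeneous symmetric function `hₖ`: the sum of all monomials of degree `k`. -/
noncomputable def h (k : ℕ) : Sym R :=
  ⟨fun d => if d.degree = k then 1 else 0, by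
    refine mem_of_invariant _ k (fun s d => ?_) (fun d hd => ?_)
    · change ite _ _ _ = ite _ _ _
      rw [degree_embDomain]
    · exact if_neg fun h => by omega⟩

open Classical in
variable (R) in
/-- The power sum symmetric function `pₖ = x₁ᵏ + x₂ᵏ + ⋯` (for `k ≥ 1`). -/
noncomputable def p (k : ℕ) : Sym R :=
  ⟨fun d => if ∃ i, d = Finsupp.single i k then 1 else 0, by
    refine mem_of_invariant _ k (fun s d => ?_) (fun d hd => ?_)
    · change ite _ _ _ = ite _ _ _
      congr 1
      refine propext ⟨?_, ?_⟩
      · rintro ⟨i, hi⟩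
        refine ⟨s.symm i, Finsupp.embDomain_injective s.toEmbedding ?_⟩
        rw [hi, Finsupp.embDomain_single]
        simp
      · rintro ⟨i, rfl⟩
        exact ⟨s i, by rw [Finsupp.embDomain_single]; simp⟩
    · refine if_neg ?_
      rintro ⟨i, rfl⟩
      simp at hd⟩

variable (R) in
/-- The power sum symmetric function `p_λ = p_{λ₁} p_{λ₂} ⋯` of a multiset `λ` of positive
integers. -/
noncomputable def pProd (l : Multiset ℕ) : Sym R := (l.map (p R)).prod

open Classical in
theorem coeff_e (k : ℕ) (d : ℕ →₀ ℕ) :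
    coeff d (e R k : MvPowerSeries ℕ R) = if d.degree = k ∧ ∀ i, d i ≤ 1 then 1 else 0 := rfl

theorem coeff_h (k : ℕ) (d : ℕ →₀ ℕ) :
    coeff d (h R k : MvPowerSeries ℕ R) = if d.degree = k then 1 else 0 := by
  classical
  change ite _ _ _ = _
  congr

theorem e_zero : e R 0 = 1 := by
  classical
  ext d
  rw [coeff_e, OneMemClass.coe_one, coeff_one]
  congr 1
  simp only [Finsupp.degree_eq_zero_iff, eq_iff_iff, and_iff_left_iff_imp]
  rintro rfl i
  simp

theorem h_zero : h R 0 = 1 := by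
  classical
  ext d
  rw [coeff_h, OneMemClass.coe_one, coeff_one]
  congr 1
  exact propext (Finsupp.degree_eq_zero_iff d)

/-- The relation `∑ (-1)ⁱ eᵢ hⱼ = 0`, the sum being over all `i + j = n`, for `n ≥ 1`. -/
theorem sum_e_mul_h (n : ℕ) (hn : n ≠ 0) :
    ∑ x ∈ Finset.HasAntidiagonal.antidiagonal n, (-1) ^ x.1 * e R x.1 * h R x.2 = 0 := by
  classical
  ext d
  have hc : ∀ x : ℕ × ℕ, coeff d (((-1) ^ x.1 * e R x.1 * h R x.2 : Sym R) : MvPowerSeries ℕ R)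
      = ∑ y ∈ Finset.HasAntidiagonal.antidiagonal d, if y.1.degree = x.1 ∧ y.2.degree = x.2 then
        (if ∀ i, y.1 i ≤ 1 then (-1) ^ y.1.degree else 0) else (0 : R) := by
    intro x
    have h1 : (((-1) ^ x.1 * e R x.1 * h R x.2 : Sym R) : MvPowerSeries ℕ R)
        = C ((-1 : R) ^ x.1) * ((e R x.1 : MvPowerSeries ℕ R) * (h R x.2 : MvPowerSeries ℕ R)) := by
      push_cast
      simp [mul_assoc]
    rw [h1, coeff_C_mul, coeff_mul, Finset.mul_sum]
    refine Finset.sum_congr rfl fun y _ => ?_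
    rw [coeff_e, coeff_h]
    by_cases h2 : y.1.degree = x.1 <;> by_cases h3 : y.2.degree = x.2 <;> simp [h2, h3]
  have hs : coeff d (((∑ x ∈ Finset.HasAntidiagonal.antidiagonal n, (-1) ^ x.1 * e R x.1 * h R x.2 : Sym R)) :
      MvPowerSeries ℕ R) = ∑ x ∈ Finset.HasAntidiagonal.antidiagonal n,
        coeff d (((-1) ^ x.1 * e R x.1 * h R x.2 : Sym R) : MvPowerSeries ℕ R) := by
    rw [AddSubmonoidClass.coe_finsetSum, map_sum]
  rw [hs, Finset.sum_congr rfl fun x _ => hc x, Finset.sum_comm]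
  change _ = (0 : R)
  by_cases hd : d.degree = n
  · have h4 : ∀ y ∈ Finset.HasAntidiagonal.antidiagonal d, (∑ x ∈ Finset.HasAntidiagonal.antidiagonal n,
        if y.1.degree = x.1 ∧ y.2.degree = x.2 then
        (if ∀ i, y.1 i ≤ 1 then (-1) ^ y.1.degree else 0) else (0 : R)) =
        if ∀ i, y.1 i ≤ 1 then (-1) ^ y.1.degree else 0 := by
      intro y hy
      rw [Finset.HasAntidiagonal.mem_antidiagonal] at hy
      rw [Finset.sum_eq_single (y.1.degree, y.2.degree)]
      · simp
      · rintro x - hx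
        refine if_neg ?_
        rintro ⟨h5, h6⟩
        exact hx (Prod.ext h5.symm h6.symm)
      · intro h5
        exact absurd (by rw [Finset.HasAntidiagonal.mem_antidiagonal, ← map_add, hy, hd]) h5
    rw [Finset.sum_congr rfl h4, ← Finset.sum_filter]
    have h0 : d.support.Nonempty := by
      rw [Finsupp.support_nonempty_iff]
      rintro rfl
      simp at hd
      omega
    have h7 := congrArg (Int.cast : ℤ → R) (Finset.sum_powerset_neg_one_pow_card_of_nonempty h0)
    push_cast at h7
    rw [← h7]
    have key : ∀ a : ℕ →₀ ℕ, (∀ i, a i ≤ 1) → a.degree = a.support.card := by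
      intro a ha
      rw [Finsupp.degree_apply, Finset.card_eq_sum_ones]
      refine Finset.sum_congr rfl fun i hi => ?_
      have := ha i
      have := Finsupp.mem_support_iff.1 hi
      omega
    refine Finset.sum_bij' (fun y _ => y.1.support)
      (fun s _ => (Finsupp.indicator s fun _ _ => 1, d - Finsupp.indicator s fun _ _ => 1))
      ?_ ?_ ?_ ?_ ?_
    · intro y hy
      rw [Finset.mem_filter, Finset.HasAntidiagonal.mem_antidiagonal] at hy
      rw [Finset.mem_powerset, ← hy.1]
      intro i hi
      rw [Finsupp.mem_support_iff] at hi ⊢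
      simp [hi]
    · intro s hs
      rw [Finset.mem_powerset] at hs
      rw [Finset.mem_filter, Finset.HasAntidiagonal.mem_antidiagonal]
      refine ⟨add_tsub_cancel_of_le ?_, ?_⟩
      · intro i
        rw [Finsupp.indicator_apply]
        split_ifs with hi
        · have := Finsupp.mem_support_iff.1 (hs hi)
          omega
        · exact Nat.zero_le _
      · intro i
        simp only [Finsupp.indicator_apply]
        split_ifs <;> simp
    · intro y hy
      rw [Finset.mem_filter, Finset.HasAntidiagonal.mem_antidiagonal] at hy
      have h8 : (Finsupp.indicator y.1.support fun _ _ => 1) = y.1 := by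
        ext i
        rw [Finsupp.indicator_apply]
        have := hy.2 i
        split_ifs with hi
        · have := Finsupp.mem_support_iff.1 hi
          omega
        · simpa using (Finsupp.notMem_support_iff.1 hi).symm
      refine Prod.ext h8 ?_
      simp only [h8]
      rw [← hy.1, add_tsub_cancel_left]
    · intro s hs
      ext i
      rw [Finsupp.mem_support_iff, Finsupp.indicator_apply]
      split_ifs with hi <;> simp [hi]
    · intro y hy
      rw [Finset.mem_filter] at hy
      rw [key _ hy.2]
  · refine Finset.sum_eq_zero fun y hy => Finset.sum_eq_zero fun x hx => ?_
    rw [Finset.HasAntidiagonal.mem_antidiagonal] at hx hy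
    refine if_neg ?_
    rintro ⟨h5, h6⟩
    apply hd
    rw [← hy, map_add, h5, h6, hx]

/-! ### The bases `e_μ` and `h_μ`, and the involution `ω` -/

variable (R) in
/-- The algebra homomorphism from the polynomial ring in variables `X₁, X₂, …` to symmetric
functions that sends `Xₖ` to `eₖ`. -/
noncomputable def eHom : MvPolynomial ℕ+ R →ₐ[R] Sym R := MvPolynomial.aeval fun k => e R k

variable (R) in
/-- The algebra homomorphism from the polynomial ring in variables `X₁, X₂, …` to symmetric
functions that sends `Xₖ` to `hₖ`. -/
noncomputable def hHom : MvPolynomial ℕ+ R →ₐ[R] Sym R := MvPolynomial.aeval fun k => h R k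

/-- Setting all variables but the first `N` to zero. -/
noncomputable def restr (N : ℕ) : MvPowerSeries ℕ R →ₐ[R] MvPowerSeries (Fin N) R :=
  killCompl Fin.valEmbedding

theorem restr_e (N k : ℕ) :
    restr N (e R k : MvPowerSeries ℕ R) = (MvPolynomial.esymm (Fin N) R k : MvPowerSeries _ R) := by
  classical
  ext d
  rw [restr, coeff_killCompl, coeff_e, degree_embDomain, embDomain_le_one_iff,
    MvPolynomial.coeff_coe, MvPolynomial.esymm_eq_sum_monomial, MvPolynomial.coeff_sum]
  simp only [MvPolynomial.coeff_monomial]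
  have key : ∀ t : Finset (Fin N), (∑ i ∈ t, Finsupp.single i 1 : Fin N →₀ ℕ) = d ↔
      (∀ i, d i ≤ 1) ∧ t = d.support := by
    intro t
    have ht : ∀ j, (∑ i ∈ t, Finsupp.single i 1 : Fin N →₀ ℕ) j = if j ∈ t then 1 else 0 := by
      intro j
      simp [Finsupp.finsetSum_apply, Finsupp.single_apply]
    constructor
    · rintro rfl
      refine ⟨fun i => by rw [ht]; split_ifs <;> simp, ?_⟩
      ext i
      rw [Finsupp.mem_support_iff, ht]
      simp
    · rintro ⟨h1, rfl⟩
      ext j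
      rw [ht]
      have := h1 j
      split_ifs with hi
      · have := Finsupp.mem_support_iff.1 hi
        omega
      · simpa using (Finsupp.notMem_support_iff.1 hi).symm
  simp only [key]
  by_cases h1 : ∀ i, d i ≤ 1
  · have h2 : d.degree = d.support.card := by
      rw [Finsupp.degree_apply, Finset.card_eq_sum_ones]
      refine Finset.sum_congr rfl fun i hi => ?_
      have := h1 i
      have := Finsupp.mem_support_iff.1 hi
      omega
    simp [h1, h2, Finset.sum_ite_eq', Finset.mem_powersetCard]
  · simp [h1]

theorem restr_eHom (N : ℕ) (Q : MvPolynomial (Fin N) R) :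
    restr N (eHom R (MvPolynomial.rename (fun i : Fin N => Nat.succPNat i) Q) : MvPowerSeries ℕ R)
      = ((MvPolynomial.esymmAlgHom (Fin N) R N Q : MvPolynomial (Fin N) R) :
        MvPowerSeries (Fin N) R) := by
  induction Q using MvPolynomial.induction_on with
  | C r =>
    rw [MvPolynomial.rename_C, ← MvPolynomial.algebraMap_eq, ← MvPolynomial.algebraMap_eq,
      AlgHom.commutes, AlgHom.commutes, Subalgebra.coe_algebraMap, AlgHom.commutes,
      Subalgebra.coe_algebraMap, MvPolynomial.algebraMap_eq, MvPolynomial.coe_C]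
    rfl
  | add P Q hP hQ => simp only [map_add, Subalgebra.coe_add, hP, hQ, MvPolynomial.coe_add]
  | mul_X P i hP =>
    simp only [map_mul, Subalgebra.coe_mul, hP, MvPolynomial.coe_mul, MvPolynomial.rename_X]
    congr 1
    rw [eHom, MvPolynomial.aeval_X, MvPolynomial.esymmAlgHom, MvPolynomial.aeval_X, restr_e]
    simp

theorem eHom_injective : Function.Injective (eHom R) := by
  rw [injective_iff_map_eq_zero]
  intro Q hQ
  obtain ⟨N, hN⟩ : ∃ N : ℕ, ∀ k ∈ Q.vars, (k : ℕ) ≤ N :=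
    ⟨Q.vars.sup fun k => (k : ℕ), fun k hk => Finset.le_sup (f := fun k : ℕ+ => (k : ℕ)) hk⟩
  obtain ⟨Q, rfl⟩ := MvPolynomial.exists_rename_eq_of_vars_subset_range Q
    (fun i : Fin N => Nat.succPNat i)
    (fun i j hij => Fin.ext (Nat.succPNat_injective hij)) (by
      intro k hk
      have h1 := hN k hk
      have h2 := k.pos
      refine ⟨⟨(k : ℕ) - 1, by omega⟩, ?_⟩
      apply PNat.eq
      simp only [Nat.succPNat_coe]
      omega)
  have h1 := restr_eHom N Q
  rw [hQ, ZeroMemClass.coe_zero, map_zero, eq_comm, MvPolynomial.coe_eq_zero_iff,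
    ZeroMemClass.coe_eq_zero] at h1
  have h2 := MvPolynomial.esymmAlgHom_injective (σ := Fin N) (n := N) R (by simp)
  rw [(injective_iff_map_eq_zero _).1 h2 _ h1, map_zero]

/-- Every exponent of degree at most `N` can be moved into the first `N` variables. -/
theorem exists_perm_embDomain (N : ℕ) (d : ℕ →₀ ℕ) (hd : d.degree ≤ N) :
    ∃ (s : Equiv.Perm ℕ) (d' : Fin N →₀ ℕ),
      d.embDomain s.toEmbedding = d'.embDomain Fin.valEmbedding := by
  classical
  have hc : d.support.card ≤ N := by
    refine le_trans ?_ hd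
    rw [Finsupp.degree_apply, Finset.card_eq_sum_ones]
    refine Finset.sum_le_sum fun i hi => ?_
    exact Nat.one_le_iff_ne_zero.2 (Finsupp.mem_support_iff.1 hi)
  obtain ⟨t, ht, htc⟩ : ∃ t ⊆ Finset.range N, t.card = d.support.card :=
    Finset.exists_subset_card_eq (by simpa using hc)
  let g : {x // x ∈ d.support} ≃ {x // x ∈ t} := Finset.equivOfCardEq htc.symm
  refine ⟨g.extendSubtype, (d.embDomain g.extendSubtype.toEmbedding).comapDomain Fin.val
    Fin.val_injective.injOn, ?_⟩
  rw [Finsupp.embDomain_eq_mapDomain (f := Fin.valEmbedding)]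
  refine (Finsupp.mapDomain_comapDomain _ Fin.val_injective _ ?_).symm
  intro i hi
  rw [Finsupp.support_embDomain] at hi
  simp only [Finset.coe_map, Set.mem_image, Finset.mem_coe] at hi
  obtain ⟨j, hj, rfl⟩ := hi
  have h1 := g.extendSubtype_mem j hj
  exact ⟨⟨g.extendSubtype j, Finset.mem_range.1 (ht h1)⟩, rfl⟩

theorem coeff_embDomain_of_mem {f : MvPowerSeries ℕ R} (hf : f ∈ Sym R) (s : Equiv.Perm ℕ)
    (d : ℕ →₀ ℕ) : coeff (d.embDomain s.toEmbedding) f = coeff d f :=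
  (renameEquiv_eq_self_iff s f).1 (hf.1 s) d

theorem homogeneousComponent_mem {f : MvPowerSeries ℕ R} (hf : f ∈ Sym R) (k : ℕ) :
    homogeneousComponent k f ∈ Sym R := by
  refine mem_of_invariant _ k (fun s d => ?_) (fun d hd => ?_)
  · rw [coeff_homogeneousComponent, coeff_homogeneousComponent, degree_embDomain,
      coeff_embDomain_of_mem hf]
  · rw [coeff_homogeneousComponent, if_neg (by omega)]

/-- Products of the `eₖ` are homogeneous. -/
theorem eHom_monomial_homogeneous (m : ℕ+ →₀ ℕ) (r : R) :
    ∃ k, ∀ d : ℕ →₀ ℕ, d.degree ≠ k →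
      coeff d (eHom R (MvPolynomial.monomial m r) : MvPowerSeries ℕ R) = 0 := by
  classical
  induction m using Finsupp.induction_linear generalizing r with
  | zero =>
    refine ⟨0, fun d hd => ?_⟩
    have h0 : d ≠ 0 := by rintro rfl; simp at hd
    have h1 : (MvPolynomial.monomial (0 : ℕ+ →₀ ℕ) r) = algebraMap R (MvPolynomial ℕ+ R) r := rfl
    rw [h1, AlgHom.commutes, Subalgebra.coe_algebraMap, MvPowerSeries.algebraMap_apply, coeff_C,
      if_neg h0]
  | add a b ha hb =>
    obtain ⟨k, hk⟩ := ha r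
    obtain ⟨l, hl⟩ := hb 1
    refine ⟨k + l, fun d hd => ?_⟩
    have h1 : MvPolynomial.monomial (a + b) r
        = MvPolynomial.monomial a r * MvPolynomial.monomial b 1 := by
      rw [MvPolynomial.monomial_mul, mul_one]
    rw [h1, map_mul, Subalgebra.coe_mul, coeff_mul]
    refine Finset.sum_eq_zero fun x hx => ?_
    rw [Finset.HasAntidiagonal.mem_antidiagonal] at hx
    have h2 : x.1.degree + x.2.degree = d.degree := by rw [← hx, map_add]
    by_cases h3 : x.1.degree = k
    · rw [hl _ (by omega), mul_zero]
    · rw [hk _ h3, zero_mul]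
  | single i n =>
    induction n generalizing r with
    | zero =>
      refine ⟨0, fun d hd => ?_⟩
      have h0 : d ≠ 0 := by rintro rfl; simp at hd
      have h1 : (MvPolynomial.monomial (Finsupp.single i 0) r)
          = algebraMap R (MvPolynomial ℕ+ R) r := by
        rw [Finsupp.single_zero]; rfl
      rw [h1, AlgHom.commutes, Subalgebra.coe_algebraMap, MvPowerSeries.algebraMap_apply, coeff_C,
        if_neg h0]
    | succ n ih =>
      obtain ⟨k, hk⟩ := ih r
      refine ⟨k + i, fun d hd => ?_⟩
      have h1 : MvPolynomial.monomial (Finsupp.single i (n + 1)) r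
          = MvPolynomial.monomial (Finsupp.single i n) r * MvPolynomial.X i := by
        rw [MvPolynomial.X, MvPolynomial.monomial_mul, mul_one, Finsupp.single_add]
      rw [h1, map_mul, Subalgebra.coe_mul, coeff_mul]
      refine Finset.sum_eq_zero fun x hx => ?_
      rw [Finset.HasAntidiagonal.mem_antidiagonal] at hx
      have h2 : x.1.degree + x.2.degree = d.degree := by rw [← hx, map_add]
      by_cases h3 : x.1.degree = k
      · rw [eHom, MvPolynomial.aeval_X, coeff_e, if_neg (fun h => by omega), mul_zero]
      · rw [hk _ h3, zero_mul]

theorem homogeneousComponent_eHom (Q : MvPolynomial ℕ+ R) (k : ℕ) :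
    ∃ P, (eHom R P : MvPowerSeries ℕ R)
      = homogeneousComponent k (eHom R Q : MvPowerSeries ℕ R) := by
  classical
  induction Q using MvPolynomial.induction_on' with
  | monomial a r =>
    obtain ⟨l, hl⟩ := eHom_monomial_homogeneous a r
    by_cases hkl : k = l
    · refine ⟨MvPolynomial.monomial a r, ?_⟩
      ext d
      rw [coeff_homogeneousComponent]
      split_ifs with hd
      · rfl
      · exact hl d (hkl ▸ hd)
    · refine ⟨0, ?_⟩
      ext d
      rw [coeff_homogeneousComponent, map_zero, ZeroMemClass.coe_zero, map_zero]
      split_ifs with hd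
      · exact (hl d (hd ▸ hkl)).symm
      · rfl
  | add P Q hP hQ =>
    obtain ⟨P', hP'⟩ := hP
    obtain ⟨Q', hQ'⟩ := hQ
    refine ⟨P' + Q', ?_⟩
    rw [map_add, map_add, Subalgebra.coe_add, Subalgebra.coe_add, map_add, hP', hQ']

theorem mem_range_of_homogeneous (f : MvPowerSeries ℕ R) (hf : f ∈ Sym R) (N : ℕ)
    (hN : ∀ d : ℕ →₀ ℕ, d.degree ≠ N → coeff d f = 0) : ∃ P, (eHom R P : MvPowerSeries ℕ R) = f := by
  classical
  let P : MvPolynomial (Fin N) R := truncTotal (N + 1) (restr N f)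
  have hP : (P : MvPowerSeries (Fin N) R) = restr N f := by
    ext d
    rw [MvPolynomial.coeff_coe]
    by_cases hd : d.degree < N + 1
    · exact coeff_truncTotal _ hd
    · rw [show P.coeff d = 0 from coeff_truncTotal_eq_zero _ (by omega), restr, coeff_killCompl,
        hN _ (by rw [degree_embDomain]; omega)]
  have hsymm : P.IsSymmetric := by
    intro s
    ext d
    obtain ⟨d, rfl⟩ : ∃ d', d'.mapDomain s = d :=
      ⟨d.mapDomain s.symm, by rw [← Finsupp.mapDomain_comp]; simp⟩
    rw [MvPolynomial.coeff_rename_mapDomain _ s.injective, ← MvPolynomial.coeff_coe,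
      ← MvPolynomial.coeff_coe, hP, restr, coeff_killCompl, coeff_killCompl,
      ← coeff_embDomain_of_mem hf (s.viaFintypeEmbedding Fin.valEmbedding)]
    congr 2
    simp only [Finsupp.embDomain_eq_mapDomain, ← Finsupp.mapDomain_comp]
    congr 1
    funext i
    exact s.viaFintypeEmbedding_apply_image Fin.valEmbedding i
  obtain ⟨Q, hQ⟩ := MvPolynomial.esymmAlgHom_surjective (σ := Fin N) (n := N) R (by simp)
    ⟨P, hsymm⟩
  obtain ⟨P', hP'⟩ := homogeneousComponent_eHom
    (MvPolynomial.rename (fun i : Fin N => Nat.succPNat i) Q) N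
  refine ⟨P', ?_⟩
  have h1 := restr_eHom N Q
  rw [hQ] at h1
  simp only [hP] at h1
  ext d
  by_cases hd : d.degree = N
  · obtain ⟨s, d', hs⟩ := exists_perm_embDomain N d hd.le
    rw [hP', coeff_homogeneousComponent, if_pos hd,
      ← coeff_embDomain_of_mem (Subtype.property _) s, ← coeff_embDomain_of_mem hf s, hs]
    simpa [restr, coeff_killCompl] using congrArg (coeff d') h1
  · rw [hP', coeff_homogeneousComponent, if_neg hd, hN d hd]

theorem eHom_surjective : Function.Surjective (eHom R) := by
  rintro ⟨f, hf⟩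
  obtain ⟨N, hN⟩ := hf.2
  have h1 : ∀ k, ∃ P, (eHom R P : MvPowerSeries ℕ R) = homogeneousComponent k f := fun k =>
    mem_range_of_homogeneous _ (homogeneousComponent_mem hf k) k fun d hd => by
      rw [coeff_homogeneousComponent, if_neg hd]
  choose P hP using h1
  refine ⟨∑ k ∈ Finset.range (N + 1), P k, ?_⟩
  ext d
  rw [map_sum, AddSubmonoidClass.coe_finsetSum, map_sum]
  simp only [hP, coeff_homogeneousComponent, Finset.sum_ite_eq, Finset.mem_range]
  split_ifs with hd
  · rfl
  · exact (hN d (by omega)).symm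

variable (R) in
/-- The `eₖ`, `k ≥ 1`, are free generators of the algebra of symmetric functions. -/
noncomputable def eEquiv : MvPolynomial ℕ+ R ≃ₐ[R] Sym R :=
  AlgEquiv.ofBijective (eHom R) ⟨eHom_injective, eHom_surjective⟩

variable (R) in
/-- The standard involution `ω` of the ring of symmetric functions: the algebra homomorphism with
`ω eₖ = hₖ` for all `k ≥ 1`. -/
noncomputable def omega : Sym R →ₐ[R] Sym R :=
  (hHom R).comp (eEquiv R).symm.toAlgHom

theorem omega_eHom (P : MvPolynomial ℕ+ R) : omega R (eHom R P) = hHom R P :=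
  congrArg (hHom R) ((eEquiv R).symm_apply_apply P)

theorem omega_e (k : ℕ) : omega R (e R k) = h R k := by
  rcases Nat.eq_zero_or_pos k with rfl | hk
  · rw [e_zero, h_zero, map_one]
  · obtain ⟨k, rfl⟩ : ∃ k' : ℕ+, (k' : ℕ) = k := ⟨⟨k, hk⟩, rfl⟩
    have h1 := omega_eHom (R := R) (MvPolynomial.X k)
    rwa [eHom, hHom, MvPolynomial.aeval_X, MvPolynomial.aeval_X] at h1

theorem omega_h (k : ℕ) : omega R (h R k) = e R k := by
  induction k using Nat.strong_induction_on with
  | _ n ih =>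
    rcases Nat.eq_zero_or_pos n with rfl | hn
    · rw [e_zero, h_zero, map_one]
    · have h1 : ∑ x ∈ Finset.HasAntidiagonal.antidiagonal n, (-1) ^ x.1 * h R x.1 * omega R (h R x.2) = 0 := by
        have := congrArg (omega R) (sum_e_mul_h (R := R) n hn.ne')
        simpa [map_sum, omega_e] using this
      have h2 : ∑ x ∈ Finset.HasAntidiagonal.antidiagonal n, (-1) ^ x.1 * h R x.1 * e R x.2 = 0 := by
        have h3 := congrArg ((-1) ^ n * ·) (sum_e_mul_h (R := R) n hn.ne')
        simp only [mul_zero, Finset.mul_sum] at h3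
        rw [← h3, ← Finset.Nat.sum_antidiagonal_swap]
        refine Finset.sum_congr rfl fun x hx => ?_
        rw [Finset.HasAntidiagonal.mem_antidiagonal] at hx
        have h4 : ((-1) ^ n * (-1) ^ x.1 : Sym R) = (-1) ^ x.2 := by
          have h6 : ∀ {S : Type _} [CommRing S] (a b : ℕ),
              ((-1) ^ (a + b) * (-1) ^ a : S) = (-1) ^ b := by
            intro S _ a b
            rw [← pow_add, show a + b + a = 2 * a + b by ring, pow_add, pow_mul, neg_one_sq,
              one_pow, one_mul]
          rw [← hx]
          exact h6 (S := Sym R) x.1 x.2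
        change (-1) ^ x.2 * h R x.2 * e R x.1 = _
        rw [← h4]
        ring
      have hmem : ((0, n) : ℕ × ℕ) ∈ Finset.HasAntidiagonal.antidiagonal n := by simp
      rw [← Finset.add_sum_erase _ _ hmem] at h1 h2
      have h5 : ∑ x ∈ (Finset.HasAntidiagonal.antidiagonal n).erase (0, n),
          (-1) ^ x.1 * h R x.1 * omega R (h R x.2)
          = ∑ x ∈ (Finset.HasAntidiagonal.antidiagonal n).erase (0, n),
            (-1) ^ x.1 * h R x.1 * e R x.2 := by
        refine Finset.sum_congr rfl fun x hx => ?_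
        rw [Finset.mem_erase, Finset.HasAntidiagonal.mem_antidiagonal] at hx
        rw [ih x.2 ?_]
        rcases Nat.eq_zero_or_pos x.1 with h6 | h6
        · exact absurd (Prod.ext h6 (by simp only; omega)) hx.1
        · omega
      rw [h5, ← h2] at h1
      simpa [h_zero] using add_right_cancel h1

theorem omega_omega (f : Sym R) : omega R (omega R f) = f := by
  have h1 : ((omega R).comp (omega R)).comp (eHom R) = eHom R := by
    ext k : 1
    simp [eHom, omega_e, omega_h]
  obtain ⟨P, rfl⟩ := eHom_surjective f
  exact DFunLike.congr_fun h1 P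

theorem hHom_bijective : Function.Bijective (hHom R) := by
  have h1 : (hHom R : MvPolynomial ℕ+ R → Sym R) = omega R ∘ eHom R :=
    funext fun P => (omega_eHom P).symm
  rw [h1]
  exact (Function.Involutive.bijective omega_omega).comp ⟨eHom_injective, eHom_surjective⟩

variable (R) in
/-- The basis of complete homogeneous symmetric functions `h_μ = h_{μ₁} h_{μ₂} ⋯`. A partition
`μ` is given by its multiplicities: `μ k` is the number of parts of `μ` equal to `k`. -/
noncomputable def hBasis : Module.Basis (ℕ+ →₀ ℕ) R (Sym R) :=
  (MvPolynomial.basisMonomials ℕ+ R).map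
    (AlgEquiv.ofBijective (hHom R) hHom_bijective).toLinearEquiv

theorem hBasis_apply (μ : ℕ+ →₀ ℕ) : hBasis R μ = μ.prod fun k a => h R k ^ a := by
  simp [hBasis, hHom, MvPolynomial.aeval_monomial]

/-! ### The Hall scalar product -/

/-- The exponent `(μ₁, μ₂, …)` of the monomial `x₁^{μ₁} x₂^{μ₂} ⋯`, where `μ₁ ≥ μ₂ ≥ ⋯` are the
parts of the partition with multiplicities `μ`. -/
noncomputable def expo (μ : ℕ+ →₀ ℕ) : ℕ →₀ ℕ :=
  (((Finsupp.toMultiset μ).map fun k : ℕ+ => (k : ℕ)).sort (· ≥ ·)).toFinsupp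

variable (R) in
/-- The coefficient of the monomial symmetric function `m_μ` in a symmetric function, that is,
its coefficient at the monomial `x₁^{μ₁} x₂^{μ₂} ⋯`. -/
noncomputable def mCoeff (μ : ℕ+ →₀ ℕ) : Sym R →ₗ[R] R :=
  (coeff (expo μ)).comp (Sym R).val.toLinearMap

variable (R) in
/-- The Hall scalar product: the bilinear form on symmetric functions for which the bases `m_λ`
and `h_μ` are dual to each other, so that `⟨f, h_μ⟩` is the coefficient of `m_μ` in `f`. -/
noncomputable def hall : Sym R →ₗ[R] Sym R →ₗ[R] R :=
  ((hBasis R).constr R (mCoeff R)).flip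

theorem hall_hBasis (f : Sym R) (μ : ℕ+ →₀ ℕ) : hall R f (hBasis R μ) = mCoeff R μ f := by
  simp [hall]

end SymFun

/-! ### Chromatic quasisymmetric functions and Hessenberg varieties

The set `[n] = {1, …, n}` is represented by `Fin n = {0, …, n - 1}`, and the colors
`1, 2, …` by `ℕ`, both with their usual order. -/

namespace Hessenberg

/-- The exponent of the monomial `x_κ = ∏ᵢ x_{κ(i)}` of a coloring `κ`. -/
noncomputable def content {n : ℕ} {G : SimpleGraph (Fin n)} (κ : G.Coloring ℕ) : ℕ →₀ ℕ :=
  ∑ i, Finsupp.single (κ i) 1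

/-- The number of ascents of a coloring `κ`: the number of edges `{i, j}` of `G` with `i < j` and
`κ i < κ j`. -/
noncomputable def asc {n : ℕ} {G : SimpleGraph (Fin n)} (κ : G.Coloring ℕ) : ℕ :=
  {x : Fin n × Fin n | G.Adj x.1 x.2 ∧ x.1 < x.2 ∧ κ x.1 < κ x.2}.ncard

theorem finite_content_eq {n : ℕ} (G : SimpleGraph (Fin n)) (d : ℕ →₀ ℕ) :
    {κ : G.Coloring ℕ | content κ = d}.Finite := by
  refine Set.Finite.of_finite_image (f := fun κ : G.Coloring ℕ => (κ : Fin n → ℕ)) ?_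
    DFunLike.coe_injective.injOn
  refine (Set.Finite.pi' fun _ : Fin n => d.support.finite_toSet).subset ?_
  rintro _ ⟨κ, rfl, rfl⟩ i
  rw [Finset.mem_coe, Finsupp.mem_support_iff, content, Finsupp.finsetSum_apply]
  have h1 : (Finsupp.single (κ i) 1 : ℕ →₀ ℕ) (κ i)
      ≤ ∑ j, (Finsupp.single (κ j) 1 : ℕ →₀ ℕ) (κ i) :=
    Finset.single_le_sum (f := fun j => (Finsupp.single (κ j) 1 : ℕ →₀ ℕ) (κ i))
      (fun _ _ => Nat.zero_le _) (Finset.mem_univ i)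
  rw [Finsupp.single_eq_same] at h1
  exact Nat.one_le_iff_ne_zero.1 h1

/-- The chromatic quasisymmetric function `X_G(x; t) = ∑ t ^ asc(κ) x_κ`, the sum being over all
proper colorings `κ` of `G`. -/
noncomputable def chromatic {R : Type*} [CommRing R] {n : ℕ} (G : SimpleGraph (Fin n)) (t : R) :
    MvPowerSeries ℕ R :=
  fun d => ∑ κ ∈ (finite_content_eq G d).toFinset, t ^ asc κ

/-- Hessenberg functions: weakly increasing functions `m : [n] → [n]` with `m i ≥ i` for all
`i`. -/
def IsHessenberg {n : ℕ} (m : Fin n → Fin n) : Prop :=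
  Monotone m ∧ ∀ i, i ≤ m i

/-- The indifference graph `G(m)`, with edges `{i, j}` for `i < j ≤ m i`. -/
def graph {n : ℕ} (m : Fin n → Fin n) : SimpleGraph (Fin n) where
  Adj i j := (i < j ∧ j ≤ m i) ∨ (j < i ∧ i ≤ m j)
  symm := ⟨fun _ _ => Or.symm⟩
  loopless := ⟨fun i hi => by simp at hi⟩

/-- The set of points of the Hessenberg variety `H(m, T)` over `F`: complete flags
`V₁ ⊆ V₂ ⊆ ⋯ ⊆ Vₙ = Fⁿ` (where `Vᵢ₊₁` is `V i`) with `T Vᵢ ⊆ V_{m(i)}` for all `i`. -/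
def variety {F : Type*} [Field F] {n : ℕ} (m : Fin n → Fin n)
    (T : (Fin n → F) →ₗ[F] (Fin n → F)) : Set (Fin n → Submodule F (Fin n → F)) :=
  {V | Monotone V ∧ (∀ i, Module.finrank F (V i) = (i : ℕ) + 1) ∧
    ∀ i, (V i).map T ≤ V (m i)}

/-- `T` is regular semisimple if its characteristic polynomial is a product of distinct (monic)
irreducible polynomials. -/
def IsRegularSemisimple {F : Type*} [Field F] {n : ℕ}
    (T : (Fin n → F) →ₗ[F] (Fin n → F)) : Prop :=
  ∃ s : Finset (Polynomial F), (∀ f ∈ s, f.Monic ∧ Irreducible f) ∧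
    T.charpoly = ∏ f ∈ s, f

open Classical in
/-- The multiset of the degrees of the distinct irreducible factors of the characteristic
polynomial of `T`. -/
noncomputable def degrees {F : Type*} [Field F] {n : ℕ}
    (T : (Fin n → F) →ₗ[F] (Fin n → F)) : Multiset ℕ :=
  (UniqueFactorizationMonoid.primeFactors T.charpoly).val.map Polynomial.natDegree

end Hessenberg

/-!
The proof compares both sides of the formula through the *modular law*, a linear relation
`(1 + q) f(h₁) = q f(h₀) + f(h₂)` between the values of a function `f` at three Hessenberg
functions whose diagrams differ by two adjacent cells (`IsModular`).

* A function that satisfies the modular law is determined by its values at the idempotent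
  Hessenberg functions `h ∘ h = h`, whose graphs are disjoint unions of complete graphs on intervals
  (`IsModular.eq_zero`). Along a family of Hessenberg functions the law becomes a recursion of order
  two, whose solutions vanish if they vanish at both ends.
* The chromatic quasisymmetric function satisfies the law (`isModular_chromaticSum`): two vertices
  that are twins up to the moving edges can exchange their colors, and what remains is an identity
  between the weights of three edges.
* The number of points of the Hessenberg variety over the field with `q` elements satisfies the law
  (`isModular_ncard_points`): off the smallest of the three varieties, one member of the flag can
  be chosen among the `q + 1` points of a projective line for `h₂`, while it is determined by the
  other members for `h₁`.

For an idempotent Hessenberg function whose intervals have the sizes `k₁, k₂, …`, the chromatic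
quasisymmetric function is `c e_{k₁} e_{k₂} ⋯` with a product `c` of `q`-integers
(`chromaticSum_of_idempotent`). As symmetric functions form a subspace, all chromatic
quasisymmetric functions of indifference graphs are symmetric. The Hall product of `p_λ` with
`ω` of this product is `c` times the coefficient of `x₁^{k₁} x₂^{k₂} ⋯` in `p_λ`, that is, `c` times
the number of ways to distribute the parts of `λ` to the intervals such that the totals are
`k₁, k₂, …` (`SymFun.hall_prod_h`, `SymFun.coeff_prod_p`). On the other side, the flags in question
are those whose members at the ends of the intervals are invariant under `T`. The invariant
subspaces of a regular semisimple operator are the sums of the kernels of `f(T)` for sets of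
irreducible factors `f` of its characteristic polynomial (`isInvariantDecomposition_ker`), so the
invariant members are given by such a distribution as well, and the remaining members can be chosen
in `c` ways (`IsInvariantDecomposition.ncard_points`).

The linear form `f ↦ ⟨p_λ, ω f⟩`, which is defined on symmetric functions only, is extended to all
power series in order to apply the first point to the difference of both sides.
-/

/-! ### The modular law and Hessenberg functions -/

namespace Hessenberg

open Function

/-- Hessenberg functions on `{0, …, n - 1}`, encoded as functions `ℕ → ℕ` whose values at
arguments `≥ n` are irrelevant. -/
def IsHess (n : ℕ) (h : ℕ → ℕ) : Prop :=
  (∀ i < n, i ≤ h i ∧ h i < n) ∧ ∀ i j, i ≤ j → j < n → h i ≤ h j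

/-- The modular law for a vector-valued function `f` of Hessenberg functions. In both forms, three
Hessenberg functions are involved that agree up to two adjacent cells, of which the diagram of the
first contains none, that of the second one and that of the third both: the cells of row `i` in the
columns `j + 1, j + 2` in the form `row`, the cells of column `c + 1` in the rows `i, i + 1` in the
form `col`. The two columns, or rows, are not distinguished by the rest of the diagram. -/
structure IsModular {W : Type*} [AddCommGroup W] [Module ℚ W] (n : ℕ) (q : ℚ)
    (f : (ℕ → ℕ) → W) : Prop where
  row : ∀ (h : ℕ → ℕ) (i j : ℕ), IsHess n h → h i = j + 1 → i ≤ j → j + 2 < n →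
    (∀ k < i, h k ≤ j) → (∀ k, i < k → k < n → j + 2 ≤ h k) → h (j + 1) = h (j + 2) →
    (1 + q) • f h = q • f (update h i j) + f (update h i (j + 2))
  col : ∀ (h : ℕ → ℕ) (i c : ℕ), IsHess n h → i + 1 < n → h i = c → h (i + 1) = c + 1 →
    (∀ k < n, h k ≠ i) →
    (1 + q) • f h = q • f (update h (i + 1) c) + f (update h i (c + 1))

variable {W : Type*} [AddCommGroup W] [Module ℚ W] {n : ℕ} {q : ℚ} {f : (ℕ → ℕ) → W}

/-- A solution of the recursion `(1 + q) g(x) = q g(x + 1) + g(x - 1)` that vanishes at two points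
vanishes in between, as its differences form a geometric progression. -/
theorem eq_zero_of_recursion (hq : 0 < q) {g : ℕ → W} {r : ℕ} (h0 : g 0 = 0) (hr : g r = 0)
    (hg : ∀ x, x + 1 < r → (1 + q) • g (x + 1) = q • g (x + 2) + g x) :
    ∀ x ≤ r, g x = 0 := by
  have h1 : ∀ x, (x ≤ r → g x = (∑ t ∈ Finset.range x, q⁻¹ ^ t) • g 1) ∧
      (x + 1 ≤ r → g (x + 1) = (∑ t ∈ Finset.range (x + 1), q⁻¹ ^ t) • g 1) := by
    intro x
    induction x with
    | zero => simp [h0]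
    | succ x ih =>
      refine ⟨ih.2, fun hx => ?_⟩
      have h2 := hg x (by omega)
      rw [ih.2 (by omega), ih.1 (by omega), ← sub_eq_iff_eq_add, smul_smul, ← sub_smul] at h2
      have h3 : g (x + 1 + 1) = q⁻¹ • q • g (x + 2) := by
        rw [smul_smul, inv_mul_cancel₀ hq.ne', one_smul]
      rw [h3, ← h2, smul_smul]
      congr 1
      rw [Finset.sum_range_succ _ (x + 1), Finset.sum_range_succ _ x]
      have h4 : q⁻¹ * q = 1 := inv_mul_cancel₀ hq.ne'
      have h5 : q⁻¹ ^ (x + 1) = q⁻¹ ^ x * q⁻¹ := pow_succ _ _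
      linear_combination (∑ t ∈ Finset.range x, q⁻¹ ^ t + q⁻¹ ^ x) * h4 - h5
  have h2 : g 1 = 0 ∨ r = 0 := by
    rcases Nat.eq_zero_or_pos r with h | h
    · exact Or.inr h
    · left
      have h3 := (h1 r).1 le_rfl
      rw [hr, eq_comm, smul_eq_zero] at h3
      refine h3.resolve_left (ne_of_gt ?_)
      exact Finset.sum_pos (fun t _ => by positivity) ⟨0, by simpa using h⟩
  intro x hx
  rcases h2 with h2 | h2
  · rw [(h1 x).1 hx, h2, smul_zero]
  · rw [show x = 0 by omega, h0]

theorem IsHess.update {h : ℕ → ℕ} (hh : IsHess n h) {i b : ℕ} (hib : i ≤ b)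
    (hlo : ∀ k < i, h k ≤ b) (hbn : b < n) (hhi : ∀ k, i < k → k < n → b ≤ h k) :
    IsHess n (update h i b) := by
  refine ⟨fun k hk => ?_, fun k l hkl hl => ?_⟩
  · rw [update_apply]
    split_ifs with h1
    · omega
    · exact hh.1 k hk
  · rw [update_apply, update_apply]
    split_ifs with h1 h2 h2
    · rfl
    · exact hhi l (by omega) hl
    · exact hlo k (by omega)
    · exact hh.2 k l hkl hl

/-- If no value of `h` before row `p` separates the rows `p, …, m`, then modulo the modular law `h`
is a combination of Hessenberg functions that agree with `h` before row `p`, are not smaller than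
`h` at `p`, and are constant on the rows `p, …, m`. The induction is downward on `p`, then downward
on `h p`. -/
theorem IsModular.eq_zero_of_const (hq : 0 < q) (hf : IsModular n q f) (p m : ℕ) (h : ℕ → ℕ)
    (hpm : p ≤ m) (hmn : m < n) (hh : IsHess n h) (hm : m ≤ h p)
    (hp : ∀ k < p, h k < p ∨ m ≤ h k)
    (H : ∀ h', IsHess n h' → (∀ k < p, h' k = h k) → h p ≤ h' p →
      (∀ k, p ≤ k → k ≤ m → h' k = h' p) → f h' = 0) : f h = 0 := by
  induction hN : n - p using Nat.strong_induction_on generalizing p m h with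
  | _ N ihp =>
  induction hM : n - h p using Nat.strong_induction_on generalizing h with
  | _ M ihb =>
  subst hN hM
  rcases hpm.eq_or_lt with rfl | hpm'
  · exact H h hh (fun _ _ => rfl) le_rfl fun k h1 h2 => by rw [le_antisymm h2 h1]
  have hbn := (hh.1 p (by omega)).2
  refine ihp (n - (p + 1)) (by omega) (p + 1) m h hpm' hmn hh
    (hm.trans (hh.2 _ _ (by omega) (by omega))) (fun k hk => ?_)
    (fun h' hh' hlo hge hconst => ?_) rfl
  · rcases Nat.lt_succ_iff_lt_or_eq.1 hk with h1 | rfl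
    · exact (hp k h1).imp_left fun h2 => by omega
    · exact Or.inr hm
  have hb : h' p = h p := hlo p (by omega)
  have hbc : h p ≤ h' (p + 1) := hb ▸ hh'.2 p (p + 1) (by omega) (by omega)
  have hcn := (hh'.1 (p + 1) (by omega)).2
  have hlob : ∀ k < p, h' k ≤ h p := fun k hk => by
    rw [hlo k (by omega)]; exact hh.2 k p hk.le (by omega)
  rcases hbc.eq_or_lt with hc | hbc
  · refine H h' hh' (fun k hk => hlo k (by omega)) hb.ge fun k h1 h2 => ?_
    rcases h1.eq_or_lt with rfl | h1
    · rfl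
    · rw [hconst k h1 h2, ← hc, hb]
  rcases (Nat.succ_le_iff.2 hbc).eq_or_lt with hc | hc
  · -- The values on the rows `p, …, m` are `h p` and `h p + 1`: vary the position of the jump.
    have key : ∀ x, IsHess n (fun k => if p ≤ k ∧ k ≤ m then (if k < p + x then h p else h p + 1)
        else h' k) := by
      intro x
      refine ⟨fun k hk => ?_, fun k l hkl hl => ?_⟩
      · simp only
        split_ifs
        · omega
        · omega
        · exact hh'.1 k hk
      · simp only
        have h1 := hh'.2 k l hkl hl
        have h2 : k < p → h' k ≤ h p := hlob k
        have h3 : m < l → h p + 1 ≤ h' l := fun h4 => by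
          have := hh'.2 (p + 1) l (by omega) hl
          omega
        split_ifs <;> omega
    have h1 := eq_zero_of_recursion hq (r := m - p + 1) (g := fun x => f fun k =>
      if p ≤ k ∧ k ≤ m then (if k < p + x then h p else h p + 1) else h' k) ?_ ?_ ?_ 1 (by omega)
    · rw [← h1]
      congr 1
      funext k
      split_ifs with h2 h3
      · rw [show k = p by omega, hb]
      · rw [hconst k (by omega) h2.2, ← hc]
      · rfl
    · refine H _ (key 0) (fun k hk => ?_) ?_ fun k h2 h3 => ?_
      · rw [if_neg (by omega), hlo k (by omega)]
      · rw [if_pos (by omega), if_neg (by omega)]; omega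
      · split_ifs <;> omega
    · refine H _ (key _) (fun k hk => ?_) ?_ fun k h2 h3 => ?_
      · rw [if_neg (by omega), hlo k (by omega)]
      · rw [if_pos (by omega), if_pos (by omega)]
      · split_ifs <;> omega
    · intro x hx
      have h2 := hf.col _ (p + x) (h p) (key (x + 1)) (by omega)
        (by rw [if_pos (by omega), if_pos (by omega)])
        (by rw [if_pos (by omega), if_neg (by omega)]) ?_
      · rw [h2]
        congr 1
        · congr 2
          funext k
          rw [update_apply]
          by_cases h3 : k = p + x + 1
          · subst h3
            rw [if_pos rfl, if_pos (by omega), if_pos (by omega)]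
          · rw [if_neg h3]
            split_ifs <;> first | rfl | omega
        · congr 1
          funext k
          rw [update_apply]
          by_cases h3 : k = p + x
          · subst h3
            rw [if_pos rfl, if_pos (by omega), if_neg (by omega)]
          · rw [if_neg h3]
            split_ifs <;> first | rfl | omega
      · intro k hk
        have h3 : k < p → h' k < p ∨ m ≤ h' k := fun h4 => by
          rw [hlo k (by omega)]; exact hp k h4
        have h4 : m < k → h p ≤ h' k := fun h5 => by
          have := hh'.2 (p + 1) k (by omega) hk
          omega
        split_ifs
        · omega
        · omega
        · omega
  · -- Row `p` can be moved up once the columns `h p + 1` and `h p + 2` have been made twins.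
    have hc1 : h p + 1 < n := by omega
    have hk1 : ∀ k, p < k → k < n → h p + 2 ≤ h' k := fun k h1 h2 => by
      have := hh'.2 (p + 1) k (by omega) h2
      omega
    refine ihp (n - (h p + 1)) (by omega) (h p + 1) (h p + 2) h' (by omega) (by omega) hh'
      (hk1 _ (by omega) hc1) (fun k hk => ?_) (fun h'' hh'' hlo2 hge2 hconst2 => ?_) rfl
    · rcases lt_trichotomy k p with h1 | rfl | h1
      · have := hlob k h1; omega
      · omega
      · exact Or.inr (hk1 k h1 (by omega))
    have hb2 : h'' p = h p := by rw [hlo2 p (by omega), hb]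
    have hlob2 : ∀ k < p, h'' k ≤ h p := fun k hk => by
      rw [hlo2 k (by omega)]; exact hlob k hk
    have hk2 : ∀ k, p < k → k < n → h p + 2 ≤ h'' k := fun k h1 h2 => by
      have h3 := hh''.2 (p + 1) k (by omega) h2
      rw [hlo2 (p + 1) (by omega)] at h3
      omega
    have up : ∀ b, h p < b → b ≤ h p + 2 → IsHess n (update h'' p b) ∧ f (update h'' p b) = 0 := by
      intro b hb1 hb3
      have hhu : IsHess n (update h'' p b) := hh''.update (by omega)
        (fun k hk => (hlob2 k hk).trans hb1.le) (by omega)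
        (fun k h1 h2 => hb3.trans (hk2 k h1 h2))
      refine ⟨hhu, ihb (n - b) (by omega) _ hhu (by rw [update_self]; omega) (fun k hk => ?_)
        (fun g hg hlog hgeg hcg => ?_) (by rw [update_self])⟩
      · rw [update_of_ne (by omega), hlo2 k (by omega), hlo k (by omega)]
        exact hp k hk
      · rw [update_self] at hgeg
        refine H g hg (fun k hk => ?_) (by omega) hcg
        rw [hlog k hk, update_of_ne (by omega), hlo2 k (by omega), hlo k (by omega)]
    obtain ⟨hh1, hf1⟩ := up (h p + 1) (by omega) (by omega)
    have hrow := hf.row _ p (h p) hh1 (update_self ..) (by omega) (by omega)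
      (fun k hk => by rw [update_of_ne (by omega)]; exact hlob2 k hk)
      (fun k h1 h2 => by rw [update_of_ne (by omega)]; exact hk2 k h1 h2)
      (by
        rw [update_of_ne (by omega), update_of_ne (by omega)]
        exact (hconst2 (h p + 2) (by omega) le_rfl).symm)
    rw [hf1, update_idem, update_idem, (up (h p + 2) (by omega) le_rfl).2, smul_zero, add_zero,
      eq_comm, smul_eq_zero] at hrow
    rw [← hrow.resolve_left hq.ne', ← hb2, update_eq_self]

/-- A function that satisfies the modular law is determined by its values at the idempotent
Hessenberg functions, whose graphs are disjoint unions of complete graphs on intervals. -/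
theorem IsModular.eq_zero (hq : 0 < q) (hf : IsModular n q f)
    (hidem : ∀ h, IsHess n h → (∀ i < n, h (h i) = h i) → f h = 0) (h : ℕ → ℕ) (hh : IsHess n h) :
    f h = 0 := by
  suffices main : ∀ N s, N = n - s → s ≤ n → ∀ h, IsHess n h →
      (∀ k < s, h k < s ∧ h (h k) = h k) → f h = 0 from
    main _ 0 rfl (Nat.zero_le n) h hh fun k hk => absurd hk (Nat.not_lt_zero k)
  intro N
  induction N using Nat.strong_induction_on with
  | _ N ihs =>
  intro s hN hs h hh hc
  rcases hs.eq_or_lt with rfl | hs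
  · exact hidem h hh fun i hi => (hc i hi).2
  induction hM : n - h s using Nat.strong_induction_on generalizing h with
  | _ M ihb =>
  have h1 := hh.1 s hs
  refine hf.eq_zero_of_const hq s (h s) h h1.1 h1.2 hh le_rfl
    (fun k hk => Or.inl (hc k hk).1) fun h' hh' hlo hge hconst => ?_
  have hc' : ∀ k < s, h' k < s ∧ h' (h' k) = h' k := fun k hk => by
    obtain ⟨h2, h3⟩ := hc k hk
    rw [hlo k hk, hlo _ h2]
    exact ⟨h2, h3⟩
  rcases hge.eq_or_lt with heq | hlt
  · refine ihs (n - (h s + 1)) (by omega) (h s + 1) rfl (by omega) h' hh' fun k hk => ?_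
    rcases lt_or_ge k s with h2 | h2
    · exact ⟨(hc' k h2).1.trans_le (by omega), (hc' k h2).2⟩
    · rw [hconst k h2 (by omega), ← heq, hconst (h s) h1.1 le_rfl, ← heq]
      exact ⟨by omega, rfl⟩
  · have := (hh'.1 s hs).2
    exact ihb (n - h' s) (by omega) h' hh' hc' rfl

end Hessenberg

/-! ### The modular law for chromatic quasisymmetric functions -/

namespace Hessenberg

open Function

variable {n : ℕ}

/-- The weight of an edge `{i, j}`, `i < j`, whose ends have the colors `x` and `y`: it vanishes if
the coloring is not proper at the edge, and it is `q` or `1` if the edge is an ascent or not. -/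
def edgeWeight (q : ℚ) (x y : ℕ) : ℚ := if x = y then 0 else if x < y then q else 1

/-- The edges `(i, j)`, `i < j ≤ h i`, of the graph of a Hessenberg function. -/
def edges (n : ℕ) (h : ℕ → ℕ) : Finset (Fin n × Fin n) :=
  {x | x.1 < x.2 ∧ (x.2 : ℕ) ≤ h x.1}

/-- The maps `κ` from `[n]` to the set of colors with `∏ᵢ x_{κ(i)}` equal to a given monomial. -/
noncomputable def mapsOfContent (n : ℕ) (d : ℕ →₀ ℕ) : Finset (Fin n → ℕ) := by
  classical
  exact {κ ∈ Fintype.piFinset fun _ => d.support | ∑ i, Finsupp.single (κ i) 1 = d}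

theorem mem_mapsOfContent {d : ℕ →₀ ℕ} {κ : Fin n → ℕ} :
    κ ∈ mapsOfContent n d ↔ ∑ i, Finsupp.single (κ i) 1 = d := by
  classical
  rw [mapsOfContent, Finset.mem_filter, and_iff_right_iff_imp, Fintype.mem_piFinset]
  rintro rfl i
  rw [Finsupp.mem_support_iff, Finsupp.finsetSum_apply]
  have h1 := Finset.single_le_sum (f := fun j => (Finsupp.single (κ j) 1 : ℕ →₀ ℕ) (κ i))
      (fun _ _ => Nat.zero_le _) (Finset.mem_univ i)
  simp only [Finsupp.single_eq_same] at h1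
  omega

/-- The chromatic quasisymmetric function of the graph of a Hessenberg function, as a sum over all
maps from the vertices to the colors, proper or not. -/
noncomputable def chromaticSum (n : ℕ) (q : ℚ) (h : ℕ → ℕ) : MvPowerSeries ℕ ℚ :=
  fun d => ∑ κ ∈ mapsOfContent n d, ∏ x ∈ edges n h, edgeWeight q (κ x.1) (κ x.2)

theorem sum_mapsOfContent_comp (d : ℕ →₀ ℕ) (s : Equiv.Perm (Fin n)) (g : (Fin n → ℕ) → ℚ) :
    ∑ κ ∈ mapsOfContent n d, g (κ ∘ s) = ∑ κ ∈ mapsOfContent n d, g κ := by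
  have h1 : ∀ (t : Equiv.Perm (Fin n)) (κ : Fin n → ℕ), κ ∈ mapsOfContent n d →
      κ ∘ t ∈ mapsOfContent n d := fun t κ hκ => by
    rw [mem_mapsOfContent] at hκ ⊢
    rw [← hκ]
    exact Equiv.sum_comp t fun i => (Finsupp.single (κ i) 1 : ℕ →₀ ℕ)
  refine Finset.sum_bij' (fun κ _ => κ ∘ s) (fun κ _ => κ ∘ s.symm) (fun κ hκ => h1 s κ hκ)
    (fun κ hκ => h1 s.symm κ hκ) ?_ ?_ ?_
  · intro κ _; funext i; simp
  · intro κ _; funext i; simp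
  · intro κ _; rfl

/-- If no value of `h` separates the vertices `a` and `a + 1`, and `h a = h (a + 1)`, then
interchanging these vertices permutes the edges other than the one between them. -/
theorem prod_edges_erase_swap {h : ℕ → ℕ} {a b : Fin n} (hab : (b : ℕ) = a + 1)
    (heq : h a = h b) (hne : ∀ k < n, h k ≠ a) (q : ℚ) (κ : Fin n → ℕ) :
    ∏ x ∈ (edges n h).erase (a, b),
        edgeWeight q ((κ ∘ Equiv.swap a b) x.1) ((κ ∘ Equiv.swap a b) x.2) =
      ∏ x ∈ (edges n h).erase (a, b), edgeWeight q (κ x.1) (κ x.2) := by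
  have h1 : ∀ x ∈ (edges n h).erase (a, b),
      (Equiv.swap a b x.1, Equiv.swap a b x.2) ∈ (edges n h).erase (a, b) := by
    rintro ⟨x, y⟩ hx
    simp only [edges, Finset.mem_erase, Finset.mem_filter, Finset.mem_univ, true_and, ne_eq,
      Prod.mk.injEq, Fin.lt_def, Fin.ext_iff] at hx ⊢
    have hx1 := hne x x.2
    have hnb : (a : ℕ) ≠ b := by omega
    rcases eq_or_ne x a with rfl | hxa
    · rw [Equiv.swap_apply_left, Equiv.swap_apply_of_ne_of_ne (by rintro rfl; omega)
        (by rintro rfl; omega)]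
      omega
    rcases eq_or_ne x b with rfl | hxb
    · rw [Equiv.swap_apply_right, Equiv.swap_apply_of_ne_of_ne (by rintro rfl; omega)
        (by rintro rfl; omega)]
      omega
    rw [Equiv.swap_apply_of_ne_of_ne hxa hxb]
    rw [ne_eq, Fin.ext_iff] at hxa hxb
    rcases eq_or_ne y a with rfl | hya
    · rw [Equiv.swap_apply_left]
      omega
    rcases eq_or_ne y b with rfl | hyb
    · rw [Equiv.swap_apply_right]
      omega
    rw [Equiv.swap_apply_of_ne_of_ne hya hyb]
    exact hx
  refine Finset.prod_bij' (fun x _ => (Equiv.swap a b x.1, Equiv.swap a b x.2))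
    (fun x _ => (Equiv.swap a b x.1, Equiv.swap a b x.2)) h1 h1 ?_ ?_ ?_
  · intro x _; simp
  · intro x _; simp
  · intro x _; rfl

/-- The modular law for sums over colorings, reduced to an identity between the weights of the three
edges that are concerned: the edge between two vertices `a` and `b = a + 1` and two further edges
`e₁` and `e₂`, which are added to the graph. -/
theorem sum_mapsOfContent_modular {h : ℕ → ℕ} {a b : Fin n} (hab : (b : ℕ) = a + 1)
    (heq : h a = h b) (hne : ∀ k < n, h k ≠ a) (hba : (b : ℕ) ≤ h a) (q : ℚ) (d : ℕ →₀ ℕ)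
    {e₁ e₂ : Fin n × Fin n} {E₁ E₂ : Finset (Fin n × Fin n)} (he₁ : e₁ ∉ edges n h)
    (he₂ : e₂ ∉ E₁) (hE₁ : E₁ = insert e₁ (edges n h)) (hE₂ : E₂ = insert e₂ E₁)
    (hloc : ∀ κ : Fin n → ℕ,
      edgeWeight q (κ a) (κ b) * ((1 + q) * edgeWeight q (κ e₁.1) (κ e₁.2) - q -
        edgeWeight q (κ e₁.1) (κ e₁.2) * edgeWeight q (κ e₂.1) (κ e₂.2)) +
      edgeWeight q (κ b) (κ a) * ((1 + q) * edgeWeight q (κ e₂.1) (κ e₂.2) - q -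
        edgeWeight q (κ e₁.1) (κ e₁.2) * edgeWeight q (κ e₂.1) (κ e₂.2)) = 0)
    (hswap : (Equiv.swap a b e₁.1, Equiv.swap a b e₁.2) = e₂) :
    (1 + q) * ∑ κ ∈ mapsOfContent n d, ∏ x ∈ E₁, edgeWeight q (κ x.1) (κ x.2) =
      q * ∑ κ ∈ mapsOfContent n d, ∏ x ∈ edges n h, edgeWeight q (κ x.1) (κ x.2) +
      ∑ κ ∈ mapsOfContent n d, ∏ x ∈ E₂, edgeWeight q (κ x.1) (κ x.2) := by
  let D : (Fin n → ℕ) → ℚ := fun κ => (∏ x ∈ (edges n h).erase (a, b),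
    edgeWeight q (κ x.1) (κ x.2)) * (edgeWeight q (κ a) (κ b) *
      ((1 + q) * edgeWeight q (κ e₁.1) (κ e₁.2) - q -
        edgeWeight q (κ e₁.1) (κ e₁.2) * edgeWeight q (κ e₂.1) (κ e₂.2)))
  have hmem : (a, b) ∈ edges n h := by
    simp only [edges, Finset.mem_filter, Finset.mem_univ, true_and, Fin.lt_def]
    omega
  have h1 : ∑ κ ∈ mapsOfContent n d, (D κ + D (κ ∘ Equiv.swap a b)) = 0 := by
    refine Finset.sum_eq_zero fun κ _ => ?_
    simp only [D]
    have h2 : edgeWeight q ((κ ∘ Equiv.swap a b) e₁.1) ((κ ∘ Equiv.swap a b) e₁.2) =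
        edgeWeight q (κ e₂.1) (κ e₂.2) := by rw [← hswap]; rfl
    have h3 : edgeWeight q ((κ ∘ Equiv.swap a b) e₂.1) ((κ ∘ Equiv.swap a b) e₂.2) =
        edgeWeight q (κ e₁.1) (κ e₁.2) := by rw [← hswap]; simp
    have h4 : (κ ∘ Equiv.swap a b) a = κ b := by simp
    have h5 : (κ ∘ Equiv.swap a b) b = κ a := by simp
    rw [prod_edges_erase_swap hab heq hne, ← mul_add, h2, h3, h4, h5, mul_eq_zero]
    right
    linear_combination hloc κ
  rw [Finset.sum_add_distrib, sum_mapsOfContent_comp, ← two_mul] at h1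
  have h2 : ∑ κ ∈ mapsOfContent n d, D κ = 0 := by linarith
  rw [← sub_eq_zero, ← h2, Finset.mul_sum, Finset.mul_sum, ← Finset.sum_add_distrib,
    ← Finset.sum_sub_distrib]
  refine Finset.sum_congr rfl fun κ _ => ?_
  rw [hE₂, Finset.prod_insert he₂, hE₁, Finset.prod_insert he₁, ← Finset.mul_prod_erase _ _ hmem]
  simp only [D]
  ring

/-- The identity between weights for a vertex `z` before the vertices that are interchanged. -/
theorem edgeWeight_identity_left (q : ℚ) (x y z : ℕ) :
    edgeWeight q x y * ((1 + q) * edgeWeight q z x - q - edgeWeight q z x * edgeWeight q z y) +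
      edgeWeight q y x * ((1 + q) * edgeWeight q z y - q - edgeWeight q z x * edgeWeight q z y)
      = 0 := by
  unfold edgeWeight
  split_ifs <;> first | omega | (subst_vars; ring)

/-- The identity between weights for a vertex `z` after the vertices that are interchanged. -/
theorem edgeWeight_identity_right (q : ℚ) (x y z : ℕ) :
    edgeWeight q x y * ((1 + q) * edgeWeight q y z - q - edgeWeight q y z * edgeWeight q x z) +
      edgeWeight q y x * ((1 + q) * edgeWeight q x z - q - edgeWeight q y z * edgeWeight q x z)
      = 0 := by
  unfold edgeWeight
  split_ifs <;> first | omega | (subst_vars; ring)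

/-- Chromatic quasisymmetric functions satisfy the modular law: colorings are paired by
interchanging the colors of the two vertices that only the moving edges distinguish. -/
theorem isModular_chromaticSum (n : ℕ) (q : ℚ) : IsModular n q (chromaticSum n q) := by
  constructor
  · intro h i j hh hi hij hj hlo hhi heq
    funext d
    have key := sum_mapsOfContent_modular (n := n) (h := update h i j) (a := ⟨j + 1, by omega⟩)
      (b := ⟨j + 2, hj⟩) rfl ?_ ?_ ?_ q d (e₁ := (⟨i, by omega⟩, ⟨j + 1, by omega⟩))
      (e₂ := (⟨i, by omega⟩, ⟨j + 2, hj⟩)) (E₁ := edges n h) (E₂ := edges n (update h i (j + 2)))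
      ?_ ?_ ?_ ?_ (fun κ => edgeWeight_identity_left q _ _ _) ?_
    · exact key
    · simp only
      rw [update_of_ne (by omega), update_of_ne (by omega), heq]
    · intro k hk
      simp only [update_apply]
      have h1 := hlo k
      have h2 := hhi k
      split_ifs <;> omega
    · simp only
      rw [update_of_ne (by omega), heq]
      exact (hh.1 (j + 2) hj).1
    · simp [edges]
    · simp [edges, hi]
    · ext ⟨x, y⟩
      simp only [edges, Finset.mem_filter, Finset.mem_univ, true_and, Finset.mem_insert,
        Prod.mk.injEq, Fin.lt_def, Fin.ext_iff, update_apply]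
      split_ifs with h1
      · rw [h1, hi]; omega
      · omega
    · ext ⟨x, y⟩
      simp only [edges, Finset.mem_filter, Finset.mem_univ, true_and, Finset.mem_insert,
        Prod.mk.injEq, Fin.lt_def, Fin.ext_iff, update_apply]
      split_ifs with h1
      · rw [h1, hi]; omega
      · omega
    · rw [Equiv.swap_apply_left, Equiv.swap_apply_of_ne_of_ne]
      · simp only [ne_eq, Fin.ext_iff]; omega
      · simp only [ne_eq, Fin.ext_iff]; omega
  · intro h i c hh hi hc hc1 hne
    funext d
    have hcn := (hh.1 (i + 1) hi).2
    have hic := hne i (by omega)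
    have hic' := (hh.1 i (by omega)).1
    have key := sum_mapsOfContent_modular (n := n) (h := update h (i + 1) c)
      (a := ⟨i, by omega⟩) (b := ⟨i + 1, hi⟩) rfl ?_ ?_ ?_ q d
      (e₁ := (⟨i + 1, hi⟩, ⟨c + 1, by omega⟩)) (e₂ := (⟨i, by omega⟩, ⟨c + 1, by omega⟩))
      (E₁ := edges n h) (E₂ := edges n (update h i (c + 1)))
      ?_ ?_ ?_ ?_ (fun κ => edgeWeight_identity_right q _ _ _) ?_
    · exact key
    · simp only
      rw [update_of_ne (by omega), update_self, hc]
    · intro k hk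
      simp only [update_apply]
      have h1 := hne k hk
      split_ifs <;> omega
    · simp only
      rw [update_of_ne (by omega)]
      omega
    · simp [edges]
    · simp [edges, hc]
    · ext ⟨x, y⟩
      simp only [edges, Finset.mem_filter, Finset.mem_univ, true_and, Finset.mem_insert,
        Prod.mk.injEq, Fin.lt_def, Fin.ext_iff, update_apply]
      split_ifs with h1
      · rw [h1, hc1]; omega
      · omega
    · ext ⟨x, y⟩
      simp only [edges, Finset.mem_filter, Finset.mem_univ, true_and, Finset.mem_insert,
        Prod.mk.injEq, Fin.lt_def, Fin.ext_iff, update_apply]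
      split_ifs with h1
      · rw [h1, hc]; omega
      · omega
    · rw [Equiv.swap_apply_right, Equiv.swap_apply_of_ne_of_ne]
      · simp only [ne_eq, Fin.ext_iff]; omega
      · simp only [ne_eq, Fin.ext_iff]; omega

/-- The extension by zero of a Hessenberg function to the natural numbers. -/
def extend (m : Fin n → Fin n) (i : ℕ) : ℕ := if hi : i < n then m ⟨i, hi⟩ else 0

@[simp]
theorem extend_val (m : Fin n → Fin n) (i : Fin n) : extend m i = m i := by
  simp [extend]

theorem IsHessenberg.isHess_extend {m : Fin n → Fin n} (hm : IsHessenberg m) :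
    IsHess n (extend m) := by
  refine ⟨fun i hi => ?_, fun i j hij hj => ?_⟩
  · rw [extend, dif_pos hi]
    exact ⟨hm.2 ⟨i, hi⟩, (m ⟨i, hi⟩).2⟩
  · rw [extend, extend, dif_pos (hij.trans_lt hj), dif_pos hj]
    exact hm.1 (show (⟨i, hij.trans_lt hj⟩ : Fin n) ≤ ⟨j, hj⟩ from hij)

theorem chromatic_eq_chromaticSum (m : Fin n → Fin n) (q : ℚ) :
    chromatic (graph m) q = chromaticSum n q (extend m) := by
  classical
  funext d
  simp only [chromatic, chromaticSum]
  have hadj : ∀ {x y}, (x, y) ∈ edges n (extend m) ↔ x < y ∧ y ≤ m x := by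
    intro x y
    simp [edges]
  rw [← Finset.sum_subset (s₁ := (finite_content_eq (graph m) d).toFinset.map
    ⟨fun κ : (graph m).Coloring ℕ => (κ : Fin n → ℕ), DFunLike.coe_injective⟩)]
  · rw [Finset.sum_map]
    refine Finset.sum_congr rfl fun κ _ => ?_
    simp only [Embedding.coeFn_mk]
    have h1 : ∀ x ∈ edges n (extend m), edgeWeight q (κ x.1) (κ x.2) =
        if κ x.1 < κ x.2 then q else 1 := by
      rintro ⟨x, y⟩ hx
      have h2 : κ x ≠ κ y := κ.valid (Or.inl (hadj.1 hx))
      simp [edgeWeight, h2]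
    rw [Finset.prod_congr rfl h1, ← Finset.prod_filter, Finset.prod_const, asc]
    congr 1
    rw [← Set.ncard_coe_finset]
    congr 1
    ext ⟨x, y⟩
    simp only [Finset.coe_filter, Set.mem_ofPred_eq, hadj, graph]
    constructor
    · rintro ⟨h2, h3, h4⟩
      exact ⟨⟨h3, by rcases h2 with h2 | h2; exacts [h2.2, absurd h2.1 h3.asymm]⟩, h4⟩
    · rintro ⟨h2, h3⟩
      exact ⟨Or.inl h2, h2.1, h3⟩
  · intro κ hκ
    simp only [Finset.mem_map, Set.Finite.mem_toFinset, Set.mem_ofPred_eq,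
      Embedding.coeFn_mk] at hκ
    obtain ⟨κ, hκ, rfl⟩ := hκ
    exact mem_mapsOfContent.2 hκ
  · intro κ hκ hκ'
    obtain ⟨x, y, hxy, heq⟩ : ∃ x y, (x, y) ∈ edges n (extend m) ∧ κ x = κ y := by
      by_contra! hc
      refine hκ' ?_
      simp only [Finset.mem_map, Set.Finite.mem_toFinset, Set.mem_ofPred_eq, Embedding.coeFn_mk]
      refine ⟨SimpleGraph.Coloring.mk κ ?_, mem_mapsOfContent.1 hκ, rfl⟩
      rintro x y (h1 | h1)
      · exact hc x y (hadj.2 h1)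
      · exact (hc y x (hadj.2 h1)).symm
    exact Finset.prod_eq_zero hxy (by simp [edgeWeight, heq])

end Hessenberg

/-! ### Counting flags over a finite field -/

namespace Hessenberg

open Function Module

theorem ncard_eq_mul_of_fibers {α β : Type*} [Finite α] {s : Set α} {t : Set β}
    (ht : t.Finite) {f : α → β} (hf : Set.MapsTo f s t) {c : ℕ}
    (hc : ∀ b ∈ t, {a ∈ s | f a = b}.ncard = c) :
    s.ncard = t.ncard * c := by
  classical
  have := Fintype.ofFinite α
  rw [Set.ncard_eq_toFinset_card', Set.ncard_eq_toFinset_card t ht,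
    Finset.card_eq_sum_card_fiberwise (f := f) (t := ht.toFinset) (by simpa using hf)]
  rw [Finset.sum_const_nat (m := c)]
  intro b hb
  rw [← hc b (by simpa using hb), Set.ncard_eq_toFinset_card']
  congr 1
  ext a
  simp

variable {F : Type*} [Field F]

section Subspaces

variable {E : Type*} [AddCommGroup E] [Module F E] [Finite E]

theorem ncard_submodule [Fintype F] (U : Submodule F E) :
    (U : Set E).ncard = Fintype.card F ^ finrank F U := by
  rw [← Nat.card_coe_set_eq, ← Nat.card_eq_fintype_card]
  exact natCard_eq_pow_finrank

theorem eq_sup_span_of_mem {U U' : Submodule F E} (hle : U ≤ U')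
    (hr : finrank F U' = finrank F U + 1) {v : E} (hv : v ∈ U') (hv' : v ∉ U) :
    U' = U ⊔ F ∙ v := by
  refine (Submodule.eq_of_le_of_finrank_le (sup_le hle ?_) ?_).symm
  · rwa [Submodule.span_singleton_le_iff_mem]
  · rw [hr, Submodule.finrank_sup_span_singleton hv']

/-- The number of subspaces of dimension `dim U + 1` between two subspaces `U ≤ W`, which is the
number of points of the projective space of `W / U`. -/
theorem ncard_subspaces_between [Fintype F] {U W : Submodule F E} (hUW : U ≤ W) :
    ({X : Submodule F E | U ≤ X ∧ X ≤ W ∧ finrank F X = finrank F U + 1}.ncard : ℚ) =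
      ∑ t ∈ Finset.range (finrank F W - finrank F U), (Fintype.card F : ℚ) ^ t := by
  set q := Fintype.card F
  have hq : (1 : ℚ) < q := by exact_mod_cast Fintype.one_lt_card
  have hpos : (0 : ℚ) < q := by linarith
  have h1 := ncard_eq_mul_of_fibers (Set.toFinite _) (s := (W : Set E) \ U)
    (f := fun v => U ⊔ F ∙ v)
    (t := {X : Submodule F E | U ≤ X ∧ X ≤ W ∧ finrank F X = finrank F U + 1})
    (c := q ^ (finrank F U + 1) - q ^ finrank F U) ?_ ?_
  · have h2 : finrank F U ≤ finrank F W := Submodule.finrank_mono hUW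
    rw [Set.ncard_sdiff (by exact_mod_cast hUW), ncard_submodule, ncard_submodule] at h1
    have h3 := congrArg (Nat.cast : ℕ → ℚ) h1
    rw [Nat.cast_mul, Nat.cast_sub (Nat.pow_le_pow_right (by exact_mod_cast hpos) h2),
      Nat.cast_sub (Nat.pow_le_pow_right (by exact_mod_cast hpos) (Nat.le_succ _))] at h3
    rw [geom_sum_eq hq.ne', eq_div_iff (by linarith)]
    push_cast at h3
    have h4 : (q : ℚ) ^ finrank F W = q ^ (finrank F W - finrank F U) * q ^ finrank F U := by
      rw [← pow_add, Nat.sub_add_cancel h2]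
    have h5 : (q : ℚ) ^ finrank F U ≠ 0 := by positivity
    rw [h4] at h3
    apply mul_right_cancel₀ h5
    rw [pow_succ] at h3
    linear_combination -h3
  · rintro v ⟨hv, hv'⟩
    refine ⟨le_sup_left, sup_le hUW ?_, Submodule.finrank_sup_span_singleton hv'⟩
    rwa [Submodule.span_singleton_le_iff_mem]
  · rintro X ⟨h1, h2, h3⟩
    have h4 : {v ∈ (W : Set E) \ U | U ⊔ F ∙ v = X} = (X : Set E) \ U := by
      ext v
      constructor
      · rintro ⟨⟨_, h5⟩, rfl⟩
        exact ⟨Submodule.mem_sup_right (Submodule.mem_span_singleton_self v), h5⟩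
      · rintro ⟨h5, h6⟩
        exact ⟨⟨h2 h5, h6⟩, (eq_sup_span_of_mem h1 h3 h5 h6).symm⟩
    rw [h4, Set.ncard_sdiff (by exact_mod_cast h1), ncard_submodule, ncard_submodule, h3]

end Subspaces

variable {n : ℕ}

/-- Complete flags in `Fⁿ`, with the space of dimension `i + 1` at the index `i`. -/
def IsFlag (V : Fin n → Submodule F (Fin n → F)) : Prop :=
  Monotone V ∧ ∀ i, finrank F (V i) = (i : ℕ) + 1

/-- The sum of the members of a sequence of subspaces before the index `j`. For a flag, it is the
member of dimension `j`, also if `j = 0`. -/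
def lower (V : Fin n → Submodule F (Fin n → F)) (j : Fin n) : Submodule F (Fin n → F) :=
  ⨆ k, ⨆ (_ : k < j), V k

theorem lower_le {V : Fin n → Submodule F (Fin n → F)} {j : Fin n} {U : Submodule F (Fin n → F)} :
    lower V j ≤ U ↔ ∀ k < j, V k ≤ U := by
  simp [lower]

theorem lower_congr {V V' : Fin n → Submodule F (Fin n → F)} {j : Fin n}
    (h : ∀ k < j, V k = V' k) : lower V j = lower V' j := by
  unfold lower
  exact iSup_congr fun k => iSup_congr fun hk => h k hk

theorem lower_eq {V : Fin n → Submodule F (Fin n → F)} {i j : Fin n}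
    (hV : ∀ k l, k ≤ l → l < j → V k ≤ V l) (hij : (j : ℕ) = i + 1) :
    lower V j = V i := by
  refine le_antisymm (lower_le.2 fun k hk => hV k i ?_ ?_) ?_
  · rw [Fin.lt_def] at hk; rw [Fin.le_def]; omega
  · rw [Fin.lt_def]; omega
  · exact le_iSup₂_of_le i (by rw [Fin.lt_def]; omega) le_rfl

theorem finrank_lower {V : Fin n → Submodule F (Fin n → F)} {j : Fin n}
    (hV : ∀ k l, k ≤ l → l < j → V k ≤ V l) (hr : ∀ k < j, finrank F (V k) = (k : ℕ) + 1) :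
    finrank F (lower V j) = j := by
  rcases Nat.eq_zero_or_pos j with h0 | hj
  · have : lower V j = ⊥ := by
      rw [eq_bot_iff, lower_le]
      intro k hk
      rw [Fin.lt_def] at hk
      omega
    rw [this, finrank_bot, h0]
  · have hij : (j : ℕ) = (⟨(j : ℕ) - 1, by omega⟩ : Fin n) + 1 := by simp only; omega
    rw [lower_eq hV hij, hr _ (by rw [Fin.lt_def]; omega)]
    omega

theorem IsFlag.finrank_lower {V : Fin n → Submodule F (Fin n → F)} (hV : IsFlag V) (j : Fin n) :
    finrank F (lower V j) = j :=
  Hessenberg.finrank_lower (fun _ _ h _ => hV.1 h) fun _ _ => hV.2 _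

theorem isFlag_update_iff {V : Fin n → Submodule F (Fin n → F)} (hV : IsFlag V) {j j' : Fin n}
    (hj : (j' : ℕ) = j + 1) (U : Submodule F (Fin n → F)) :
    IsFlag (update V j U) ↔ lower V j ≤ U ∧ U ≤ V j' ∧ finrank F U = (j : ℕ) + 1 := by
  have hjj : j' ≠ j := fun h => by rw [h] at hj; omega
  constructor
  · rintro ⟨h1, h2⟩
    refine ⟨lower_le.2 fun k hk => ?_, ?_, ?_⟩
    · have := h1 hk.le
      rwa [update_self, update_of_ne hk.ne] at this
    · have := h1 (show j ≤ j' by rw [Fin.le_def]; omega)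
      rwa [update_self, update_of_ne hjj] at this
    · have := h2 j
      rwa [update_self] at this
  · rintro ⟨h1, h2, h3⟩
    refine ⟨fun k l hkl => ?_, fun k => ?_⟩
    · rw [update_apply, update_apply]
      split_ifs with hk hl hl
      · exact le_rfl
      · refine h2.trans (hV.1 ?_)
        rw [Fin.le_def] at hkl ⊢
        rw [Fin.ext_iff] at hl hk
        omega
      · refine lower_le.1 h1 k ?_
        rw [← hl]
        exact lt_of_le_of_ne hkl fun h => hk (h.trans hl)
      · exact hV.1 hkl
    · rcases eq_or_ne k j with rfl | hk
      · rw [update_self, h3]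
      · rw [update_of_ne hk, hV.2 k]

theorem ncard_isFlag_update [Fintype F] {V : Fin n → Submodule F (Fin n → F)} (hV : IsFlag V)
    {j j' : Fin n} (hj : (j' : ℕ) = j + 1) : {U | IsFlag (update V j U)}.ncard = Fintype.card F + 1 := by
  have hle : lower V j ≤ V j' := lower_le.2 fun k hk => hV.1 <| by
    rw [Fin.lt_def] at hk; rw [Fin.le_def]; omega
  have h1 := ncard_subspaces_between hle
  rw [hV.finrank_lower, hV.2, show (j' : ℕ) + 1 - j = 2 by omega] at h1
  simp only [isFlag_update_iff hV hj]
  have h2 : ∑ t ∈ Finset.range 2, (Fintype.card F : ℚ) ^ t = ((Fintype.card F + 1 : ℕ) : ℚ) := by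
    rw [Finset.sum_range_succ, Finset.sum_range_one]
    push_cast
    ring
  rw [h2] at h1
  exact_mod_cast h1

/-- Three nested sets of flags satisfy the modular law if the largest and the smallest do not depend
on the space at the index `j`, and if outside the smallest set, membership in the intermediate set
prescribes the space at the index `j` in terms of the others. -/
theorem ncard_modular [Fintype F] {A₀ A₁ A₂ : Set (Fin n → Submodule F (Fin n → F))} {j j' : Fin n}
    (hj : (j' : ℕ) = j + 1) (h01 : A₀ ⊆ A₁) (h12 : A₁ ⊆ A₂) (hflag : ∀ V ∈ A₂, IsFlag V)
    (h0 : ∀ V ∈ A₀, ∀ U, IsFlag (update V j U) → update V j U ∈ A₀)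
    (h2 : ∀ V ∈ A₂, ∀ U, IsFlag (update V j U) → update V j U ∈ A₂)
    (K : (Fin n → Submodule F (Fin n → F)) → Submodule F (Fin n → F))
    (hK : ∀ V U, K (update V j U) = K V)
    (hKflag : ∀ V ∈ A₂ \ A₀, IsFlag (update V j (K V)))
    (hKmem : ∀ V ∈ A₂ \ A₀, V ∈ A₁ ↔ V j = K V) :
    (1 + (Fintype.card F : ℚ)) * A₁.ncard = Fintype.card F * A₀.ncard + A₂.ncard := by
  have h02 : ∀ V ∈ A₂ \ A₀, ∀ U, IsFlag (update V j U) → update V j U ∈ A₂ \ A₀ := by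
    rintro V ⟨hV2, hV0⟩ U hU
    refine ⟨h2 V hV2 U hU, fun h => hV0 ?_⟩
    have h3 := h0 _ h (V j)
    rw [update_idem, update_eq_self] at h3
    exact h3 (hflag V hV2)
  have key : (A₂ \ A₀).ncard = (A₁ \ A₀).ncard * (Fintype.card F + 1) := by
    refine ncard_eq_mul_of_fibers (Set.toFinite _) (f := fun V => update V j (K V))
      (fun V hV => ?_) fun V hV => ?_
    · have h3 := h02 V hV _ (hKflag V hV)
      refine ⟨(hKmem _ h3).2 ?_, h3.2⟩
      rw [update_self, hK]
    · have hV2 : V ∈ A₂ \ A₀ := ⟨h12 hV.1, hV.2⟩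
      have hVK := (hKmem V hV2).1 hV.1
      rw [← ncard_isFlag_update (hflag V hV2.1) hj,
        ← Set.ncard_image_of_injective _ (update_injective V j)]
      congr 1
      ext V'
      constructor
      · rintro ⟨h3, h4⟩
        have h5 : update V j (V' j) = V' := by rw [← h4, update_idem, update_eq_self]
        exact ⟨V' j, by rw [Set.mem_ofPred_eq, h5]; exact hflag _ h3.1, h5⟩
      · rintro ⟨U, hU, rfl⟩
        refine ⟨h02 V hV2 U hU, ?_⟩
        rw [hK, update_idem, ← hVK, update_eq_self]
  rw [Set.ncard_sdiff (h01.trans h12), Set.ncard_sdiff h01] at key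
  have h3 := Set.ncard_le_ncard h01
  have h4 := Set.ncard_le_ncard (h01.trans h12)
  have h5 := congrArg (Nat.cast : ℕ → ℚ) key
  rw [Nat.cast_mul, Nat.cast_sub h3, Nat.cast_sub h4] at h5
  push_cast at h5
  linear_combination -h5

/-- The set of points of the Hessenberg variety, for a Hessenberg function on the natural
numbers. -/
def points (T : (Fin n → F) →ₗ[F] (Fin n → F)) (h : ℕ → ℕ) :
    Set (Fin n → Submodule F (Fin n → F)) :=
  {V | IsFlag V ∧ ∀ i k : Fin n, h i = k → (V i).map T ≤ V k}

theorem variety_eq_points (m : Fin n → Fin n) (T : (Fin n → F) →ₗ[F] (Fin n → F)) :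
    variety m T = points T (extend m) := by
  ext V
  simp only [variety, points, IsFlag, Set.mem_ofPred_eq, extend_val, Fin.val_inj, forall_eq',
    and_assoc]

/-- If no space is mapped into `V j`, and `V j` and `V (j + 1)` are mapped into the same space, then
`V j` may be replaced by any space between its neighbors. -/
theorem update_mem_points {T : (Fin n → F) →ₗ[F] (Fin n → F)} {h : ℕ → ℕ} {j j' : Fin n}
    (hj : (j' : ℕ) = j + 1) (heq : h j = h j') (hne : ∀ k < n, h k ≠ j)
    {V : Fin n → Submodule F (Fin n → F)} (hV : V ∈ points T h) (U : Submodule F (Fin n → F))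
    (hU : IsFlag (update V j U)) : update V j U ∈ points T h := by
  refine ⟨hU, fun i k hik => ?_⟩
  have hkj : k ≠ j := fun h1 => hne i i.2 (hik.trans (by rw [h1]))
  rw [update_of_ne hkj, update_apply]
  split_ifs with hi
  · subst hi
    exact (Submodule.map_mono ((isFlag_update_iff hV.1 hj U).1 hU).2.1).trans
      (hV.2 j' k (heq ▸ hik))
  · exact hV.2 i k hik

/-- The numbers of points of Hessenberg varieties satisfy the modular law. In the form `row`, the
space that varies is `V (j + 1)`, and it is prescribed as `V j + T (V i)`; in the form `col`, it is
`V i`, and it is prescribed as the preimage of `V c` in `V (i + 1)`. -/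
theorem isModular_ncard_points [Fintype F] (T : (Fin n → F) →ₗ[F] (Fin n → F)) :
    IsModular n (Fintype.card F) fun h => ((points T h).ncard : ℚ) := by
  constructor
  · intro h i j hh hi hij hj hlo hhi heq
    have hin : i < n := by omega
    have hjn : j < n := by omega
    have hjn' : j + 1 < n := by omega
    have hVj : ∀ V : Fin n → Submodule F (Fin n → F), IsFlag V →
        lower V ⟨j + 1, hjn'⟩ = V ⟨j, hjn⟩ := fun V hV =>
      lower_eq (fun _ _ h _ => hV.1 h) rfl
    -- A flag satisfies the conditions off row `i` or not, independently of `h i`.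
    have hrow : ∀ b, b < n → ∀ V, V ∈ points T (update h i b) ↔ (IsFlag V ∧ (∀ x k : Fin n,
        (x : ℕ) ≠ i → h x = k → (V x).map T ≤ V k)) ∧
        ∀ x k : Fin n, (x : ℕ) = i → (k : ℕ) = b → (V x).map T ≤ V k := by
      intro b hb V
      rw [and_assoc]
      refine and_congr_right fun _ => ?_
      constructor
      · refine fun h1 => ⟨fun x k hx hk => h1 x k (by rw [update_of_ne hx, hk]), fun x k hx hk =>
          h1 x k (by rw [hx, update_self, hk])⟩
      · rintro ⟨h1, h2⟩ x k hk
        by_cases hx : (x : ℕ) = i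
        · exact h2 x k hx (by rw [← hk, hx, update_self])
        · exact h1 x k hx (by rwa [update_of_ne hx] at hk)
    have hrow1 := hrow (j + 1) (by omega)
    rw [← hi, update_eq_self] at hrow1
    have hstep : ∀ b b', b ≤ b' → b' < n → points T (update h i b) ⊆ points T (update h i b') := by
      intro b b' hbb hb' V hV
      rw [hrow b (by omega)] at hV
      rw [hrow b' hb']
      exact ⟨hV.1, fun x k hx hk => (hV.2 x ⟨b, by omega⟩ hx rfl).trans
        (hV.1.1.1 (by rw [Fin.le_def]; simp only; omega))⟩
    have hcl : ∀ b, b < n → b ≠ j + 1 → ∀ V ∈ points T (update h i b), ∀ U,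
        IsFlag (update V ⟨j + 1, hjn'⟩ U) →
        update V ⟨j + 1, hjn'⟩ U ∈ points T (update h i b) := by
      intro b hb hbj V hV U hU
      refine update_mem_points (j' := ⟨j + 2, hj⟩) rfl ?_ (fun k hk => ?_) hV U hU
      · simp only
        rw [update_of_ne (by omega), update_of_ne (by omega), heq]
      · simp only [update_apply]
        have h1 := hlo k
        have h2 := hhi k
        split_ifs <;> omega
    have hsub : ∀ b, points T (update h i b) ⊆ {V | IsFlag V} := fun b V hV => hV.1
    -- Outside `A₀`, the space `T V_i` has dimension one modulo `V_j`.
    have hnot : ∀ V ∈ points T (update h i (j + 2)) \ points T (update h i j), ∃ v,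
        v ∉ V ⟨j, hjn⟩ ∧ v ∈ V ⟨j + 2, hj⟩ ∧
        lower V ⟨j + 1, hjn'⟩ ⊔ (V ⟨i, hin⟩).map T = V ⟨j, hjn⟩ ⊔ F ∙ v := by
      rintro V ⟨hV, hV0⟩
      rw [hrow (j + 2) hj] at hV
      rw [hrow j (by omega)] at hV0
      push Not at hV0
      obtain ⟨x, k, hx, hk, hxk⟩ := hV0 hV.1
      obtain rfl : x = ⟨i, hin⟩ := Fin.ext hx
      obtain rfl : k = ⟨j, hjn⟩ := Fin.ext hk
      obtain ⟨v, hv, hv'⟩ := SetLike.not_le_iff_exists.1 hxk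
      obtain ⟨w, hw, rfl⟩ := Submodule.mem_map.1 hv
      have hlow : (lower V ⟨i, hin⟩).map T ≤ V ⟨j, hjn⟩ := by
        rw [Submodule.map_le_iff_le_comap, lower_le]
        intro k hk
        rw [Fin.lt_def] at hk
        rw [← Submodule.map_le_iff_le_comap]
        have hkn := (hh.1 k k.2).2
        refine (hV.1.2 k ⟨h k, hkn⟩ hk.ne rfl).trans (hV.1.1.1 ?_)
        rw [Fin.le_def]
        exact hlo k hk
      have hVi : V ⟨i, hin⟩ = lower V ⟨i, hin⟩ ⊔ F ∙ w := by
        refine eq_sup_span_of_mem (lower_le.2 fun k hk => hV.1.1.1 hk.le) ?_ hw fun h1 => hv' ?_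
        · rw [hV.1.1.2, hV.1.1.finrank_lower]
        · exact hlow (Submodule.mem_map_of_mem h1)
      refine ⟨T w, hv', hV.2 _ ⟨j + 2, hj⟩ rfl rfl hv, ?_⟩
      rw [hVj V hV.1.1, hVi, Submodule.map_sup, Submodule.map_span, Set.image_singleton,
        ← sup_assoc, sup_eq_left.2 hlow]
    have key := ncard_modular (A₀ := points T (update h i j)) (A₁ := points T h)
      (A₂ := points T (update h i (j + 2))) (j := ⟨j + 1, hjn'⟩) (j' := ⟨j + 2, hj⟩) rfl
      ?_ ?_ (hsub _) (hcl j (by omega) (by omega)) (hcl (j + 2) hj (by omega))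
      (fun V => lower V ⟨j + 1, hjn'⟩ ⊔ (V ⟨i, hin⟩).map T) ?_ ?_ ?_
    · simpa only [smul_eq_mul] using key
    · have := hstep j (h i) (by omega) (by omega)
      rwa [update_eq_self] at this
    · have := hstep (h i) (j + 2) (by omega) (by omega)
      rwa [update_eq_self] at this
    · intro V U
      rw [lower_congr fun k hk => update_of_ne hk.ne _ _, update_of_ne]
      rw [ne_eq, Fin.ext_iff]
      simp only
      omega
    · intro V hV
      obtain ⟨v, hv, hv', heqv⟩ := hnot V hV
      have hVf := hV.1.1
      rw [heqv, isFlag_update_iff hVf (j' := ⟨j + 2, hj⟩) rfl, hVj V hVf]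
      refine ⟨le_sup_left, sup_le (hVf.1 (by rw [Fin.le_def]; simp)) ?_, ?_⟩
      · rwa [Submodule.span_singleton_le_iff_mem]
      · rw [Submodule.finrank_sup_span_singleton hv, hVf.2]
    · intro V hV
      obtain ⟨v, hv, hv', heqv⟩ := hnot V hV
      have hVf := hV.1.1
      have hV1 := (hrow _ hj V).1 hV.1
      rw [hrow1]
      constructor
      · rintro ⟨h1, h2⟩
        refine (Submodule.eq_of_le_of_finrank_le (sup_le ?_ (h2 _ _ rfl hi.symm)) ?_).symm
        · exact lower_le.2 fun k hk => hVf.1 hk.le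
        · rw [heqv, Submodule.finrank_sup_span_singleton hv, hVf.2, hVf.2]
      · intro h1
        refine ⟨hV1.1, fun x k hx hk => ?_⟩
        obtain rfl : x = ⟨i, hin⟩ := Fin.ext hx
        obtain rfl : k = ⟨j + 1, hjn'⟩ := Fin.ext (hk.trans hi)
        rw [h1]
        exact le_sup_right
  · intro h i c hh hi hc hc1 hne
    have hin : i < n := by omega
    have hcn := (hh.1 (i + 1) hi).2
    have hcn' : c < n := by omega
    have hcn'' : c + 1 < n := by omega
    have hic := hne i (by omega)
    have hic' := (hh.1 i (by omega)).1
    have hmem : ∀ V : Fin n → Submodule F (Fin n → F), ∀ b b', b ≤ c + 1 → b' ≤ c + 1 →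
        (V ∈ points T (update (update h i b) (i + 1) b') ↔ (IsFlag V ∧ (∀ x k : Fin n,
          (x : ℕ) ≠ i → (x : ℕ) ≠ i + 1 → h x = k → (V x).map T ≤ V k)) ∧
          (∀ x k : Fin n, (x : ℕ) = i → (k : ℕ) = b → (V x).map T ≤ V k) ∧
          ∀ x k : Fin n, (x : ℕ) = i + 1 → (k : ℕ) = b' → (V x).map T ≤ V k) := by
      intro V b b' hb hb'
      rw [and_assoc]
      refine and_congr_right fun _ => ?_
      constructor
      · refine fun h1 =>
          ⟨fun x k hx hx' hk => h1 x k (by rw [update_of_ne hx', update_of_ne hx, hk]),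
          fun x k hx hk => h1 x k (by rw [hx, update_of_ne (by omega), update_self, hk]),
          fun x k hx hk => h1 x k (by rw [hx, update_self, hk])⟩
      · rintro ⟨h1, h2, h3⟩ x k hk
        by_cases hx' : (x : ℕ) = i + 1
        · exact h3 x k hx' (by rw [← hk, hx', update_self])
        rw [update_of_ne hx'] at hk
        by_cases hx : (x : ℕ) = i
        · exact h2 x k hx (by rw [← hk, hx, update_self])
        · exact h1 x k hx hx' (by rwa [update_of_ne hx] at hk)
    have h0 : update h (i + 1) c = update (update h i c) (i + 1) c := by
      rw [← hc, update_eq_self]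
    have h1 : h = update (update h i c) (i + 1) (c + 1) := by
      rw [← hc1, ← hc, update_eq_self, update_eq_self]
    have h2 : update h i (c + 1) = update (update h i (c + 1)) (i + 1) (c + 1) := by
      rw [eq_comm, update_eq_iff, update_of_ne (by omega)]
      exact ⟨hc1.symm, fun _ _ => rfl⟩
    have hmem0 := fun V => hmem V c c (by omega) (by omega)
    have hmem1 := fun V => hmem V c (c + 1) (by omega) (by omega)
    have hmem2 := fun V => hmem V (c + 1) (c + 1) (by omega) (by omega)
    rw [← h0] at hmem0
    rw [← h1] at hmem1
    rw [← h2] at hmem2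
    -- Outside `A₀`, the space of all `v ∈ V_{i+1}` with `T v ∈ V_c` is a hyperplane in `V_{i+1}`.
    have hnot : ∀ V ∈ points T (update h i (c + 1)) \ points T (update h (i + 1) c),
        finrank F ↥(V ⟨i + 1, hi⟩ ⊓ (V ⟨c, hcn'⟩).comap T) = i + 1 := by
      rintro V ⟨hV, hV0⟩
      rw [hmem2] at hV
      have hxk : ¬ (V ⟨i + 1, hi⟩).map T ≤ V ⟨c, hcn'⟩ := by
        refine fun h3 => hV0 ((hmem0 V).2 ⟨hV.1, fun x k hx hk => ?_, fun x k hx hk => ?_⟩)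
        · obtain rfl : k = ⟨c, hcn'⟩ := Fin.ext hk
          exact (Submodule.map_mono (hV.1.1.1 (by rw [Fin.le_def]; simp only; omega))).trans h3
        · obtain rfl : k = ⟨c, hcn'⟩ := Fin.ext hk
          obtain rfl : x = ⟨i + 1, hi⟩ := Fin.ext hx
          exact h3
      obtain ⟨v, hv, hv'⟩ := SetLike.not_le_iff_exists.1 hxk
      obtain ⟨w, hw, rfl⟩ := Submodule.mem_map.1 hv
      have hVc : V ⟨c + 1, hcn''⟩ = V ⟨c, hcn'⟩ ⊔ F ∙ T w :=
        eq_sup_span_of_mem (hV.1.1.1 (by rw [Fin.le_def]; simp))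
          (by rw [hV.1.1.2, hV.1.1.2]) (hV.2.2 _ _ rfl rfl hv) hv'
      have h3 : V ⟨i + 1, hi⟩ = (V ⟨i + 1, hi⟩ ⊓ (V ⟨c, hcn'⟩).comap T) ⊔ F ∙ w := by
        refine le_antisymm (fun u hu => ?_) (sup_le inf_le_left ?_)
        · have h4 := hV.2.2 ⟨i + 1, hi⟩ ⟨c + 1, hcn''⟩ rfl rfl (Submodule.mem_map_of_mem hu)
          rw [hVc, Submodule.mem_sup] at h4
          obtain ⟨y, hy, z, hz, hyz⟩ := h4
          obtain ⟨a, rfl⟩ := Submodule.mem_span_singleton.1 hz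
          refine Submodule.mem_sup.2 ⟨u - a • w, ⟨?_, ?_⟩, a • w,
            Submodule.smul_mem _ _ (Submodule.mem_span_singleton_self w), sub_add_cancel _ _⟩
          · exact Submodule.sub_mem _ hu (Submodule.smul_mem _ _ hw)
          · rw [SetLike.mem_coe, Submodule.mem_comap, map_sub, map_smul, ← hyz,
              add_sub_cancel_right]
            exact hy
        · rwa [Submodule.span_singleton_le_iff_mem]
      have h4 := hV.1.1.2 ⟨i + 1, hi⟩
      have h5 : w ∉ V ⟨i + 1, hi⟩ ⊓ (V ⟨c, hcn'⟩).comap T := fun h5 => hv' h5.2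
      rw [h3, Submodule.finrank_sup_span_singleton h5] at h4
      exact Nat.add_right_cancel h4
    have key := ncard_modular (A₀ := points T (update h (i + 1) c)) (A₁ := points T h)
      (A₂ := points T (update h i (c + 1))) (j := ⟨i, hin⟩) (j' := ⟨i + 1, hi⟩) rfl
      ?_ ?_ (fun V hV => hV.1)
      (fun V => update_mem_points (j' := ⟨i + 1, hi⟩) rfl ?_ ?_)
      (fun V => update_mem_points (j' := ⟨i + 1, hi⟩) rfl ?_ ?_)
      (fun V => V ⟨i + 1, hi⟩ ⊓ (V ⟨c, hcn'⟩).comap T) ?_ ?_ ?_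
    · simpa only [smul_eq_mul] using key
    · intro V hV
      rw [hmem0] at hV
      rw [hmem1]
      refine ⟨hV.1, hV.2.1, fun x k hx hk => (hV.2.2 x ⟨c, hcn'⟩ hx rfl).trans (hV.1.1.1 ?_)⟩
      rw [Fin.le_def]; simp only; omega
    · intro V hV
      rw [hmem1] at hV
      rw [hmem2]
      refine ⟨hV.1, fun x k hx hk => (hV.2.1 x ⟨c, hcn'⟩ hx rfl).trans (hV.1.1.1 ?_), hV.2.2⟩
      rw [Fin.le_def]; simp only; omega
    · simp only
      rw [update_of_ne (by omega), update_self, hc]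
    · intro k hk
      simp only [update_apply]
      have h3 := hne k hk
      split_ifs <;> omega
    · simp only
      rw [update_self, update_of_ne (by omega), hc1]
    · intro k hk
      simp only [update_apply]
      have h3 := hne k hk
      split_ifs <;> omega
    · intro V U
      rw [update_of_ne, update_of_ne]
      · rw [ne_eq, Fin.ext_iff]; simp only; omega
      · rw [ne_eq, Fin.ext_iff]; simp
    · intro V hV
      have hVf := hV.1.1
      have hV2 := (hmem2 V).1 hV.1
      rw [isFlag_update_iff hVf (j' := ⟨i + 1, hi⟩) rfl]
      refine ⟨lower_le.2 fun k hk => le_inf (hVf.1 ?_) ?_, inf_le_left, hnot V hV⟩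
      · rw [Fin.lt_def] at hk; rw [Fin.le_def]; simp only at hk ⊢; omega
      · rw [Fin.lt_def] at hk
        simp only at hk
        rw [← Submodule.map_le_iff_le_comap]
        have hkn := (hh.1 k k.2).2
        refine (hV2.1.2 k ⟨h k, hkn⟩ hk.ne (by omega) rfl).trans (hVf.1 ?_)
        rw [Fin.le_def]
        exact (hh.2 k i hk.le (by omega)).trans hc.le
    · intro V hV
      have hVf := hV.1.1
      have hV2 := (hmem2 V).1 hV.1
      rw [hmem1]
      constructor
      · rintro ⟨_, h3, _⟩
        refine Submodule.eq_of_le_of_finrank_le (le_inf (hVf.1 ?_) ?_) ?_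
        · rw [Fin.le_def]; simp
        · rw [← Submodule.map_le_iff_le_comap]
          exact h3 _ _ rfl rfl
        · rw [hnot V hV, hVf.2]
      · intro h3
        refine ⟨hV2.1, fun x k hx hk => ?_, hV2.2.2⟩
        obtain rfl : x = ⟨i, hin⟩ := Fin.ext hx
        obtain rfl : k = ⟨c, hcn'⟩ := Fin.ext hk
        rw [h3, Submodule.map_le_iff_le_comap]
        exact inf_le_right

end Hessenberg

/-! ### Counting sequences of successive choices -/

namespace Hessenberg

open Function Module

/-- The weighted number of sequences in which each term is chosen from a finite set depending on the
preceding terms is a product, if the total weight of each choice does not depend on the preceding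
ones. -/
theorem sum_sequences {α : Type*} [DecidableEq α] [Inhabited α] (B : Finset α) (n : ℕ)
    (A : Fin n → (Fin n → α) → Finset α) (w : Fin n → (Fin n → α) → α → ℚ) (c : Fin n → ℚ)
    (hB : ∀ i v, A i v ⊆ B)
    (hA : ∀ i v v', (∀ k < i, v k = v' k) → A i v = A i v')
    (hw : ∀ i v v', (∀ k < i, v k = v' k) → w i v = w i v')
    (hc : ∀ i v, (∀ k < i, v k ∈ A k v) → ∑ a ∈ A i v, w i v a = c i) :
    ∑ v ∈ Fintype.piFinset fun _ : Fin n => B with ∀ i, v i ∈ A i v, ∏ i, w i v (v i) =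
      ∏ i, c i := by
  induction n with
  | zero => simp
  | succ n ih =>
    have hsnoc : ∀ (v : Fin n → α) (a b : α) (i : Fin (n + 1)), ∀ k < i,
        (Fin.snoc v a : Fin (n + 1) → α) k = (Fin.snoc v b : Fin (n + 1) → α) k := by
      intro v a b i k hk
      have hkn : (k : ℕ) < n := by
        have := i.2
        rw [Fin.lt_def] at hk
        omega
      obtain ⟨k, rfl⟩ : ∃ k' : Fin n, k'.castSucc = k := ⟨⟨k, hkn⟩, rfl⟩
      rw [Fin.snoc_castSucc, Fin.snoc_castSucc]
    have hcs : ∀ (v v' : Fin n → α) (i : Fin n), (∀ k < i, v k = v' k) → ∀ k < i.castSucc,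
        (Fin.snoc v default : Fin (n + 1) → α) k = (Fin.snoc v' default : Fin (n + 1) → α) k := by
      intro v v' i h k hk
      have hkn : (k : ℕ) < n := by
        have := i.2
        rw [Fin.lt_def, Fin.val_castSucc] at hk
        omega
      obtain ⟨k, rfl⟩ : ∃ k' : Fin n, k'.castSucc = k := ⟨⟨k, hkn⟩, rfl⟩
      rw [Fin.snoc_castSucc, Fin.snoc_castSucc]
      exact h k hk
    have key := ih (fun i v => A i.castSucc (Fin.snoc v default))
      (fun i v => w i.castSucc (Fin.snoc v default)) (fun i => c i.castSucc) (fun i v => hB _ _)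
      (fun i v v' h => hA _ _ _ (hcs v v' i h)) (fun i v v' h => hw _ _ _ (hcs v v' i h))
      (fun i v h => hc _ _ fun k hk => by
        have hkn : (k : ℕ) < n := by
          have := i.2
          rw [Fin.lt_def, Fin.val_castSucc] at hk
          omega
        obtain ⟨k, rfl⟩ : ∃ k' : Fin n, k'.castSucc = k := ⟨⟨k, hkn⟩, rfl⟩
        rw [Fin.snoc_castSucc]
        exact h k hk)
    rw [Fin.prod_univ_castSucc, ← key, Finset.sum_mul]
    have h1 : ∀ v ∈ ({v ∈ Fintype.piFinset fun _ : Fin n => B |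
        ∀ i, v i ∈ A i.castSucc (Fin.snoc v default)} : Finset (Fin n → α)),
        (∏ i, w i.castSucc (Fin.snoc v default) (v i)) * c (Fin.last n) =
        ∑ a ∈ A (Fin.last n) (Fin.snoc v default),
          (∏ i, w i.castSucc (Fin.snoc v default) (v i)) *
            w (Fin.last n) (Fin.snoc v default) a := by
      intro v hv
      rw [Finset.mem_filter] at hv
      rw [← Finset.mul_sum, hc]
      intro k hk
      have hkn : (k : ℕ) < n := by rwa [Fin.lt_def, Fin.val_last] at hk
      obtain ⟨k, rfl⟩ : ∃ k' : Fin n, k'.castSucc = k := ⟨⟨k, hkn⟩, rfl⟩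
      rw [Fin.snoc_castSucc]
      exact hv.2 k
    rw [Finset.sum_congr rfl h1, Finset.sum_sigma']
    refine Finset.sum_bij' (fun v _ => ⟨Fin.init v, v (Fin.last n)⟩)
      (fun x _ => Fin.snoc x.1 x.2) ?_ ?_ ?_ ?_ ?_
    · intro v hv
      rw [Finset.mem_filter, Fintype.mem_piFinset] at hv
      have h2 : ∀ i, A i (Fin.snoc (Fin.init v) default) = A i v := fun i => by
        conv_rhs => rw [← Fin.snoc_init_self v]
        exact hA _ _ _ (hsnoc _ _ _ i)
      rw [Finset.mem_sigma, Finset.mem_filter, Fintype.mem_piFinset]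
      refine ⟨⟨fun i => hv.1 _, fun i => ?_⟩, ?_⟩
      · rw [h2]; exact hv.2 _
      · simp only; rw [h2]; exact hv.2 _
    · rintro ⟨v, a⟩ hx
      rw [Finset.mem_sigma, Finset.mem_filter, Fintype.mem_piFinset] at hx
      have h2 : ∀ i, A i (Fin.snoc v a) = A i (Fin.snoc v default) := fun i =>
        hA _ _ _ (hsnoc _ _ _ i)
      rw [Finset.mem_filter, Fintype.mem_piFinset]
      refine ⟨fun i => ?_, fun i => ?_⟩
      · induction i using Fin.lastCases with
        | last => simp only [Fin.snoc_last]; exact hB _ _ hx.2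
        | cast i => simp only [Fin.snoc_castSucc]; exact hx.1.1 i
      · rw [h2]
        induction i using Fin.lastCases with
        | last => simp only [Fin.snoc_last]; exact hx.2
        | cast i => simp only [Fin.snoc_castSucc]; exact hx.1.2 i
    · intro v _; exact Fin.snoc_init_self v
    · rintro ⟨v, a⟩ _; simp
    · intro v _
      have h2 : ∀ i, w i (Fin.snoc (Fin.init v) default) = w i v := fun i => by
        conv_rhs => rw [← Fin.snoc_init_self v]
        exact hw _ _ _ (hsnoc _ _ _ i)
      rw [Fin.prod_univ_castSucc, h2]
      simp only [h2]
      rfl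

variable {F : Type*} [Field F] {n : ℕ}

/-- The `q`-analogue of the number of elements of `[n]` from `i` to `h i`. -/
def qInterval (q : ℚ) (h : ℕ → ℕ) (i : ℕ) : ℚ := ∑ t ∈ Finset.range (h i + 1 - i), q ^ t

/-- The number of complete flags with given spaces at the indices that are fixed by an idempotent
Hessenberg function. -/
theorem ncard_flags_of_chain [Fintype F] {h : ℕ → ℕ} (hh : IsHess n h)
    (hid : ∀ i < n, h (h i) = h i)
    (W : ℕ → Submodule F (Fin n → F)) (hW : ∀ i < n, h i = i → finrank F (W i) = i + 1)
    (hmono : ∀ i j, i ≤ j → j < n → W (h i) ≤ W (h j)) :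
    ({V : Fin n → Submodule F (Fin n → F) | IsFlag V ∧
      ∀ i : Fin n, h i = i → V i = W i}.ncard : ℚ) =
      ∏ i : Fin n, qInterval (Fintype.card F) h i := by
  classical
  have := Fintype.ofFinite (Submodule F (Fin n → F))
  let A : Fin n → (Fin n → Submodule F (Fin n → F)) → Finset (Submodule F (Fin n → F)) :=
    fun i V => {U | lower V i ≤ U ∧ U ≤ W (h i) ∧ finrank F U = (i : ℕ) + 1}
  have hAmem : ∀ {i V U}, U ∈ A i V ↔
      lower V i ≤ U ∧ U ≤ W (h i) ∧ finrank F U = (i : ℕ) + 1 := by simp [A]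
  have key := sum_sequences Finset.univ n A (fun _ _ _ => 1)
    (fun i => qInterval (Fintype.card F) h i) (fun _ _ => Finset.subset_univ _)
    (fun i v v' hv => by simp only [A, lower_congr hv]) (fun _ _ _ _ => rfl) ?_
  · rw [← key]
    simp only [Finset.prod_const_one, Finset.sum_const, nsmul_eq_mul, mul_one]
    rw [← Set.ncard_coe_finset]
    congr 2
    ext V
    simp only [Set.mem_ofPred_eq, Finset.coe_filter, Fintype.mem_piFinset, Finset.mem_univ,
      implies_true, true_and, hAmem]
    constructor
    · rintro ⟨hV, hVW⟩ i
      refine ⟨lower_le.2 fun k hk => hV.1 hk.le, ?_, hV.2 i⟩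
      have h1 := hh.1 i i.2
      rw [← hVW ⟨h i, h1.2⟩ (hid i i.2)]
      exact hV.1 h1.1
    · intro hV
      refine ⟨⟨fun k l hkl => ?_, fun i => (hV i).2.2⟩, fun i hi => ?_⟩
      · rcases hkl.eq_or_lt with rfl | hkl
        · exact le_rfl
        · exact lower_le.1 (hV l).1 k hkl
      · have h1 := (hV i).2.1
        rw [hi] at h1
        exact Submodule.eq_of_le_of_finrank_eq h1 (by rw [(hV i).2.2, hW i i.2 hi])
  · intro i V hV
    have h1 : finrank F (lower V i) = i := by
      refine finrank_lower (fun k l hkl hl => ?_) fun k hk => (hAmem.1 (hV k hk)).2.2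
      rcases hkl.eq_or_lt with rfl | hkl
      · exact le_rfl
      · exact lower_le.1 (hAmem.1 (hV l hl)).1 k hkl
    have h2 : lower V i ≤ W (h i) := lower_le.2 fun k hk =>
      (hAmem.1 (hV k hk)).2.1.trans (hmono k i hk.le i.2)
    have h3 := ncard_subspaces_between h2
    rw [h1, hW (h i) (hh.1 i i.2).2 (hid i i.2)] at h3
    rw [qInterval, ← h3, Finset.sum_const, nsmul_eq_mul, mul_one, ← Set.ncard_coe_finset]
    congr 2
    ext U
    simp [hAmem]

end Hessenberg

/-! ### Chromatic quasisymmetric functions of disjoint unions of complete graphs -/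

namespace Hessenberg

open Function
open scoped Finset

variable {n : ℕ} {h : ℕ → ℕ} {q : ℚ}

/-- The number of arguments at which a Hessenberg function has the value `e`. -/
def blockSize (n : ℕ) (h : ℕ → ℕ) (e : ℕ) : ℕ := #{i : Fin n | h i = e}

theorem mem_edges_iff (hh : IsHess n h) (hid : ∀ i < n, h (h i) = h i) {i j : Fin n} :
    (i, j) ∈ edges n h ↔ i < j ∧ h i = h j := by
  simp only [edges, Finset.mem_filter, Finset.mem_univ, true_and]
  refine and_congr_right fun hij => ⟨fun h1 => le_antisymm ?_ ?_, fun h1 => ?_⟩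
  · exact hh.2 i j hij.le j.2
  · have h2 := hh.2 j (h i) h1 (hh.1 i i.2).2
    rwa [hid i i.2] at h2
  · rw [h1]; exact (hh.1 j j.2).1

theorem card_block_ge (hh : IsHess n h) (hid : ∀ i < n, h (h i) = h i) (i : Fin n) :
    #{k : Fin n | i ≤ k ∧ h k = h i} = h i + 1 - i := by
  have h1 : ({k : Fin n | i ≤ k ∧ h k = h i} : Finset (Fin n)) =
      Finset.Icc i ⟨h i, (hh.1 i i.2).2⟩ := by
    ext k
    simp only [Finset.mem_filter, Finset.mem_univ, true_and, Finset.mem_Icc]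
    refine and_congr_right fun hik => ⟨fun h1 => ?_, fun h1 => le_antisymm ?_ ?_⟩
    · rw [Fin.le_def]
      simp only [← h1]
      exact (hh.1 k k.2).1
    · have h2 := hh.2 k (h i) h1 (hh.1 i i.2).2
      rwa [hid i i.2] at h2
    · exact hh.2 i k hik k.2
  rw [h1, Fin.card_Icc]

/-- The sum of `q` to the number of larger elements, over the elements of a finite set. -/
theorem sum_pow_card_gt (q : ℚ) (A : Finset ℕ) :
    ∑ a ∈ A, q ^ #{c ∈ A | a < c} = ∑ t ∈ Finset.range #A, q ^ t := by
  induction A using Finset.induction_on_min with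
  | empty => simp
  | insert a s hs ih =>
    have has : a ∉ s := fun h => (hs a h).false
    rw [Finset.sum_insert has, Finset.card_insert_of_notMem has, Finset.sum_range_succ, ← ih,
      add_comm]
    congr 1
    · refine Finset.sum_congr rfl fun x hx => ?_
      rw [Finset.filter_insert, if_neg (hs x hx).asymm]
    · congr 2
      rw [Finset.filter_insert, if_neg (lt_irrefl a)]
      exact Finset.filter_true_of_mem hs

/-- The colors from the set `S (h i)` which a map has not used, before the vertex `i`, on the block
of `i`. -/
def availableColors (h : ℕ → ℕ) (S : ℕ → Finset ℕ) (i : Fin n) (κ : Fin n → ℕ) : Finset ℕ :=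
  {c ∈ S (h i) | ∀ k < i, h k = h i → κ k ≠ c}

theorem card_availableColors (hh : IsHess n h) (hid : ∀ i < n, h (h i) = h i) {S : ℕ → Finset ℕ}
    (hS : ∀ e < n, #(S e) = blockSize n h e) (i : Fin n) (κ : Fin n → ℕ)
    (hκ : ∀ k < i, κ k ∈ availableColors h S k κ) :
    #(availableColors h S i κ) = h i + 1 - i := by
  classical
  have h1 : availableColors h S i κ =
      S (h i) \ ({k : Fin n | k < i ∧ h k = h i} : Finset (Fin n)).image κ := by
    ext c
    simp [availableColors]
  have hinj : Set.InjOn κ ({k : Fin n | k < i ∧ h k = h i} : Finset (Fin n)) := by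
    intro k hk l hl hkl
    simp only [Finset.coe_filter, Finset.mem_univ, true_and, Set.mem_ofPred_eq] at hk hl
    by_contra hne
    rcases lt_or_gt_of_ne hne with h2 | h2
    · exact (Finset.mem_filter.1 (hκ l hl.1)).2 k h2 (hk.2.trans hl.2.symm) hkl
    · exact (Finset.mem_filter.1 (hκ k hk.1)).2 l h2 (hl.2.trans hk.2.symm) hkl.symm
  have hsub : ({k : Fin n | k < i ∧ h k = h i} : Finset (Fin n)).image κ ⊆ S (h i) := by
    intro c hc
    obtain ⟨k, hk, rfl⟩ := Finset.mem_image.1 hc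
    simp only [Finset.mem_filter, Finset.mem_univ, true_and] at hk
    rw [← hk.2]
    exact (Finset.mem_filter.1 (hκ k hk.1)).1
  rw [h1, Finset.card_sdiff_of_subset hsub, Finset.card_image_of_injOn hinj,
    hS _ (hh.1 i i.2).2, blockSize, ← card_block_ge hh hid i,
    ← Finset.card_filter_add_card_filter_not (s := ({k : Fin n | h k = h i} : Finset (Fin n)))
      (fun k => k < i), Finset.filter_filter, Finset.filter_filter]
  simp only [not_lt, and_comm]
  omega

/-- In a map built from available colors, the ascents that start at a vertex correspond to the
available colors that are larger than the color of this vertex. -/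
theorem prod_edges_eq (hh : IsHess n h) (hid : ∀ i < n, h (h i) = h i) {S : ℕ → Finset ℕ}
    (hS : ∀ e < n, #(S e) = blockSize n h e) (κ : Fin n → ℕ)
    (hκ : ∀ k, κ k ∈ availableColors h S k κ) :
    ∏ x ∈ edges n h, edgeWeight q (κ x.1) (κ x.2) =
      ∏ i, q ^ #{c ∈ availableColors h S i κ | κ i < c} := by
  classical
  have hne : ∀ i j : Fin n, i < j → h i = h j → κ i ≠ κ j := fun i j hij heq =>
    (Finset.mem_filter.1 (hκ j)).2 i hij heq
  have h1 : edges n h = ({x | x.1 < x.2 ∧ h x.1 = h x.2} : Finset (Fin n × Fin n)) := by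
    ext ⟨i, j⟩
    rw [mem_edges_iff hh hid]
    simp
  rw [h1, Finset.prod_filter, Fintype.prod_prod_type]
  refine Finset.prod_congr rfl fun i _ => ?_
  have himage : availableColors h S i κ =
      ({k : Fin n | i ≤ k ∧ h k = h i} : Finset (Fin n)).image κ := by
    refine (Finset.eq_of_subset_of_card_le ?_ ?_).symm
    · intro c hc
      obtain ⟨k, hk, rfl⟩ := Finset.mem_image.1 hc
      simp only [Finset.mem_filter, Finset.mem_univ, true_and] at hk
      refine Finset.mem_filter.2 ⟨?_, fun l hl hli => ?_⟩
      · rw [← hk.2]; exact (Finset.mem_filter.1 (hκ k)).1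
      · exact hne l k (hl.trans_le hk.1) (hli.trans hk.2.symm)
    · rw [card_availableColors hh hid hS i κ fun k _ => hκ k, Finset.card_image_of_injOn,
        card_block_ge hh hid]
      intro k hk l hl hkl
      simp only [Finset.coe_filter, Finset.mem_univ, true_and, Set.mem_ofPred_eq] at hk hl
      by_contra hkl'
      rcases lt_or_gt_of_ne hkl' with h2 | h2
      · exact hne k l h2 (hk.2.trans hl.2.symm) hkl
      · exact hne l k h2 (hl.2.trans hk.2.symm) hkl.symm
  have h2 : ∀ j, (if i < j ∧ h i = h j then edgeWeight q (κ i) (κ j) else 1) =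
      if i < j ∧ h i = h j ∧ κ i < κ j then q else 1 := by
    intro j
    by_cases h3 : i < j ∧ h i = h j
    · have h4 := hne i j h3.1 h3.2
      simp [edgeWeight, h3.1, h3.2, h4]
    · rw [if_neg h3, if_neg fun h4 => h3 ⟨h4.1, h4.2.1⟩]
  simp only [h2]
  rw [← Finset.prod_filter, Finset.prod_const]
  congr 1
  rw [himage, Finset.filter_image, Finset.card_image_of_injOn]
  · congr 1
    ext j
    simp only [Finset.mem_filter, Finset.mem_univ, true_and]
    constructor
    · rintro ⟨h3, h4, h5⟩
      exact ⟨⟨h3.le, h4.symm⟩, h5⟩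
    · rintro ⟨⟨h3, h4⟩, h5⟩
      refine ⟨lt_of_le_of_ne h3 ?_, h4.symm, h5⟩
      rintro rfl
      exact h5.false
  · intro k hk l hl hkl
    simp only [Finset.coe_filter, Finset.mem_filter, Finset.mem_univ, true_and,
      Set.mem_ofPred_eq] at hk hl
    by_contra hkl'
    rcases lt_or_gt_of_ne hkl' with h2 | h2
    · exact hne k l h2 (hk.1.2.trans hl.1.2.symm) hkl
    · exact hne l k h2 (hl.1.2.trans hk.1.2.symm) hkl.symm

/-- The part of the content of a map that comes from the block of vertices on which `h` has the
value `e`. -/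
noncomputable def blockContent (h : ℕ → ℕ) (κ : Fin n → ℕ) (e : Fin n) : ℕ →₀ ℕ :=
  ∑ i ∈ ({i : Fin n | h i = e} : Finset (Fin n)), Finsupp.single (κ i) 1

theorem blockContent_apply (κ : Fin n → ℕ) (e : Fin n) (c : ℕ) :
    blockContent h κ e c = #{i : Fin n | h i = e ∧ κ i = c} := by
  rw [blockContent, Finsupp.finsetSum_apply]
  simp only [Finsupp.single_apply]
  rw [Finset.sum_boole, Finset.filter_filter, Nat.cast_id]

theorem degree_blockContent (κ : Fin n → ℕ) (e : Fin n) :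
    (blockContent h κ e).degree = blockSize n h e := by
  rw [blockContent, map_sum]
  simp [blockSize]

theorem sum_blockContent (hh : IsHess n h) (κ : Fin n → ℕ) :
    ∑ e, blockContent h κ e = ∑ i, Finsupp.single (κ i) 1 := by
  rw [← Finset.sum_fiberwise Finset.univ (fun i : Fin n => (⟨h i, (hh.1 i i.2).2⟩ : Fin n))
    (fun i => Finsupp.single (κ i) 1)]
  refine Finset.sum_congr rfl fun e _ => ?_
  rw [blockContent]
  simp [Fin.ext_iff]

/-- The sum of the weights of the maps with given color sets on the blocks. -/
theorem sum_filter_blockContent (hh : IsHess n h) (hid : ∀ i < n, h (h i) = h i) (q : ℚ)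
    {d : ℕ →₀ ℕ} {l : Fin n → ℕ →₀ ℕ} (hl : ∑ e, l e = d)
    (hdeg : ∀ e, (l e).degree = blockSize n h e) (hsq : ∀ e c, l e c ≤ 1) :
    ∑ κ ∈ mapsOfContent n d with blockContent h κ = l,
        ∏ x ∈ edges n h, edgeWeight q (κ x.1) (κ x.2) = ∏ i : Fin n, qInterval q h i := by
  classical
  let S : ℕ → Finset ℕ := fun e => if he : e < n then (l ⟨e, he⟩).support else ∅
  have hSe : ∀ e : Fin n, S e = (l e).support := fun e => by simp [S]
  have hcard : ∀ e : Fin n, (l e).support.card = blockSize n h e := by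
    intro e
    rw [← hdeg, Finsupp.degree_apply, Finset.card_eq_sum_ones]
    refine Finset.sum_congr rfl fun c hc => ?_
    have := hsq e c
    have := Finsupp.mem_support_iff.1 hc
    omega
  have hS : ∀ e < n, #(S e) = blockSize n h e := fun e he => by
    have h1 := hSe ⟨e, he⟩
    simp only at h1
    rw [h1]
    exact hcard ⟨e, he⟩
  let B : Finset ℕ := Finset.univ.biUnion fun i : Fin n => S (h i)
  have key := sum_sequences B n (availableColors h S)
    (fun i κ a => q ^ #{c ∈ availableColors h S i κ | a < c}) (fun i => qInterval q h i)
    (fun i κ => (Finset.filter_subset _ _).trans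
      (Finset.subset_biUnion_of_mem (fun i : Fin n => S (h i)) (Finset.mem_univ i)))
    ?_ ?_ ?_
  · rw [← key]
    have hset : ({κ ∈ mapsOfContent n d | blockContent h κ = l} : Finset (Fin n → ℕ)) =
        {κ ∈ Fintype.piFinset fun _ : Fin n => B | ∀ i, κ i ∈ availableColors h S i κ} := by
      ext κ
      rw [Finset.mem_filter, Finset.mem_filter, mem_mapsOfContent]
      constructor
      · rintro ⟨_, rfl⟩
        have h1 : ∀ i : Fin n, κ i ∈ S (h i) := by
          intro i
          have h2 := hSe ⟨h i, (hh.1 i i.2).2⟩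
          simp only at h2
          rw [h2, Finsupp.mem_support_iff, blockContent_apply, Finset.card_ne_zero]
          exact ⟨i, by simp⟩
        refine ⟨Fintype.mem_piFinset.2 fun i => Finset.mem_biUnion.2 ⟨i, Finset.mem_univ i, h1 i⟩,
          fun i => Finset.mem_filter.2 ⟨h1 i, fun k hk hki hκ => ?_⟩⟩
        have h2 := hsq ⟨h i, (hh.1 i i.2).2⟩ (κ i)
        rw [blockContent_apply, Finset.card_le_one] at h2
        exact hk.ne (h2 k (by simp [hki, hκ]) i (by simp))
      · rintro ⟨_, h1⟩
        have h2 : blockContent h κ = l := by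
          funext e
          have hinj : Set.InjOn κ ({i : Fin n | h i = e} : Finset (Fin n)) := by
            intro k hk j hj hkj
            simp only [Finset.coe_filter, Finset.mem_univ, true_and, Set.mem_ofPred_eq] at hk hj
            by_contra hne
            rcases lt_or_gt_of_ne hne with h2 | h2
            · exact (Finset.mem_filter.1 (h1 j)).2 k h2 (hk.trans hj.symm) hkj
            · exact (Finset.mem_filter.1 (h1 k)).2 j h2 (hj.trans hk.symm) hkj.symm
          have himg : ({i : Fin n | h i = e} : Finset (Fin n)).image κ = (l e).support := by
            refine Finset.eq_of_subset_of_card_le (fun c hc => ?_) ?_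
            · obtain ⟨k, hk, rfl⟩ := Finset.mem_image.1 hc
              simp only [Finset.mem_filter, Finset.mem_univ, true_and] at hk
              rw [← hSe, ← hk]
              exact (Finset.mem_filter.1 (h1 k)).1
            · rw [Finset.card_image_of_injOn hinj, hcard, blockSize]
          ext c
          rw [blockContent_apply]
          have hle : #{i : Fin n | h i = e ∧ κ i = c} ≤ 1 := by
            rw [Finset.card_le_one]
            intro i hi j hj
            simp only [Finset.mem_filter, Finset.mem_univ, true_and] at hi hj
            exact hinj (by simp [hi.1]) (by simp [hj.1]) (hi.2.trans hj.2.symm)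
          have hiff : l e c ≠ 0 ↔ #{i : Fin n | h i = e ∧ κ i = c} ≠ 0 := by
            rw [← Finsupp.mem_support_iff, ← himg, Finset.mem_image, Finset.card_ne_zero]
            simp only [Finset.Nonempty, Finset.mem_filter, Finset.mem_univ, true_and]
          have := hsq e c
          omega
        refine ⟨?_, h2⟩
        rw [← sum_blockContent hh, h2, hl]
    rw [hset]
    exact Finset.sum_congr rfl fun κ hκ =>
      prod_edges_eq hh hid hS κ (Finset.mem_filter.1 hκ).2
  · intro i κ κ' hκ
    ext c
    simp only [availableColors, Finset.mem_filter]
    refine and_congr_right fun _ => forall₂_congr fun k hk => ?_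
    rw [hκ k hk]
  · intro i κ κ' hκ
    have h1 : availableColors h S i κ = availableColors h S i κ' := by
      ext c
      simp only [availableColors, Finset.mem_filter]
      refine and_congr_right fun _ => forall₂_congr fun k hk => ?_
      rw [hκ k hk]
    funext a
    rw [h1]
  · intro i κ hκ
    rw [sum_pow_card_gt, card_availableColors hh hid hS i κ hκ, qInterval]

/-- For a disjoint union of complete graphs on intervals, the chromatic quasisymmetric function is a
multiple of the product of the elementary symmetric functions of the sizes of the intervals. -/
theorem chromaticSum_of_idempotent (hh : IsHess n h) (hid : ∀ i < n, h (h i) = h i) (q : ℚ) :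
    chromaticSum n q h = (((∏ i : Fin n, qInterval q h i) •
      ∏ e : Fin n, SymFun.e ℚ (blockSize n h e) : SymFun.Sym ℚ) : MvPowerSeries ℕ ℚ) := by
  classical
  ext d
  have h1 : MvPowerSeries.coeff d (((∏ i : Fin n, qInterval q h i) •
      ∏ e : Fin n, SymFun.e ℚ (blockSize n h e) : SymFun.Sym ℚ) : MvPowerSeries ℕ ℚ) =
      (∏ i : Fin n, qInterval q h i) * MvPowerSeries.coeff d
        (∏ e : Fin n, (SymFun.e ℚ (blockSize n h e) : MvPowerSeries ℕ ℚ)) := by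
    rw [← smul_eq_mul, ← map_smul]
    congr 1
    simp
  rw [h1, MvPowerSeries.coeff_prod, Finset.mul_sum]
  change ∑ κ ∈ mapsOfContent n d, _ = _
  rw [← Finset.sum_fiberwise_of_maps_to
    (g := fun κ => (Finsupp.equivFunOnFinite.symm (blockContent h κ) : Fin n →₀ ℕ →₀ ℕ))
    (t := Finset.univ.finsuppAntidiag d)]
  · refine Finset.sum_congr rfl fun l hl => ?_
    rw [Finset.mem_finsuppAntidiag] at hl
    have h2 : ∀ κ : Fin n → ℕ, (Finsupp.equivFunOnFinite.symm (blockContent h κ) = l ↔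
        blockContent h κ = l) := fun κ => by
      rw [Equiv.symm_apply_eq]; rfl
    simp only [h2]
    simp only [SymFun.coeff_e]
    by_cases hgood : ∀ e, (l e).degree = blockSize n h e ∧ ∀ c, l e c ≤ 1
    · rw [Finset.prod_congr rfl fun e _ => if_pos (hgood e), Finset.prod_const_one, mul_one]
      exact sum_filter_blockContent hh hid q hl.1 (fun e => (hgood e).1) fun e => (hgood e).2
    · push Not at hgood
      obtain ⟨e, he⟩ := hgood
      rw [Finset.prod_eq_zero (i := e) (s := Finset.univ) (f := fun i => if (l i).degree =
        blockSize n h i ∧ ∀ c, l i c ≤ 1 then (1 : ℚ) else 0) (Finset.mem_univ e), mul_zero]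
      · refine Finset.sum_eq_zero fun κ hκ => ?_
        rw [Finset.mem_filter] at hκ
        rw [← hκ.2] at he
        obtain ⟨c, hc⟩ := he (degree_blockContent κ e)
        rw [blockContent_apply, Finset.one_lt_card] at hc
        obtain ⟨i, hi, j, hj, hij⟩ := hc
        simp only [Finset.mem_filter, Finset.mem_univ, true_and] at hi hj
        rcases lt_or_gt_of_ne hij with h3 | h3
        · refine Finset.prod_eq_zero
            ((mem_edges_iff hh hid).2 ⟨h3, hi.1.trans hj.1.symm⟩) ?_
          simp [edgeWeight, hi.2, hj.2]
        · refine Finset.prod_eq_zero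
            ((mem_edges_iff hh hid).2 ⟨h3, hj.1.trans hi.1.symm⟩) ?_
          simp [edgeWeight, hi.2, hj.2]
      · refine if_neg fun h3 => ?_
        obtain ⟨c, hc⟩ := he h3.1
        exact absurd (h3.2 c) (by omega)
  · intro κ hκ
    rw [Finset.mem_finsuppAntidiag]
    refine ⟨?_, Finset.subset_univ _⟩
    rw [← mem_mapsOfContent.1 hκ, ← sum_blockContent hh]
    rfl

end Hessenberg

/-! ### Invariant subspaces of regular semisimple operators -/

namespace Hessenberg

open Function Module Polynomial
open scoped Finset

section Charpoly

variable {F : Type*} [Field F]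

/-- For commuting elements `a` and `b` of an algebra, `a - b` divides `p(a) - p(b)`. -/
theorem exists_aeval_sub_aeval {A : Type*} [Ring A] [Algebra F A] {a b : A} (hab : Commute a b)
    (p : F[X]) : ∃ c, aeval a p - aeval b p = (a - b) * c := by
  induction p using Polynomial.induction_on' with
  | add p r hp hr =>
    obtain ⟨c, hc⟩ := hp
    obtain ⟨d, hd⟩ := hr
    exact ⟨c + d, by rw [map_add, map_add, mul_add, ← hc, ← hd]; abel⟩
  | monomial k r =>
    have h1 : ∃ c, a ^ k - b ^ k = (a - b) * c := by
      induction k with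
      | zero => exact ⟨0, by simp⟩
      | succ k ih =>
        obtain ⟨c, hc⟩ := ih
        refine ⟨c * a + b ^ k, ?_⟩
        have h2 : (a - b) * b ^ k = b ^ k * (a - b) := by
          rw [sub_mul, mul_sub, (hab.pow_right k).eq, (Commute.refl b).pow_right k |>.eq]
        rw [mul_add, ← mul_assoc, ← hc, h2, pow_succ, pow_succ]
        noncomm_ring
    obtain ⟨c, hc⟩ := h1
    refine ⟨algebraMap F A r * c, ?_⟩
    rw [aeval_monomial, aeval_monomial, ← mul_sub, hc, ← mul_assoc, ← mul_assoc,
      Algebra.commutes]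

/-- The characteristic polynomial divides a power of the minimal polynomial: take determinants in
`μ(X) = μ(X) - μ(M) = (X - M) B`. -/
theorem charpoly_dvd_minpoly_pow {ι : Type*} [Fintype ι] [DecidableEq ι] (M : Matrix ι ι F) :
    M.charpoly ∣ minpoly F M ^ Fintype.card ι := by
  let b : Matrix ι ι F[X] := M.map C
  let a : Matrix ι ι F[X] := algebraMap F[X] _ X
  have hb : ∀ p : F[X], aeval b p = (aeval M p).map C := fun p => by
    have := aeval_algHom_apply (AlgHom.mapMatrix (m := ι) (CAlgHom : F →ₐ[F] F[X])) M p
    exact this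
  have ha : ∀ p : F[X], aeval a p = algebraMap F[X] (Matrix ι ι F[X]) p := fun p => by
    rw [aeval_algebraMap_apply, aeval_X_left_apply]
  obtain ⟨c, hc⟩ := exists_aeval_sub_aeval (F := F) (a := a) (b := b) (Algebra.commutes _ _)
    (minpoly F M)
  rw [ha, hb, minpoly.aeval, Matrix.map_zero _ (by simp), sub_zero] at hc
  have h1 := congrArg Matrix.det hc
  rw [Matrix.det_mul, Matrix.algebraMap_eq_diagonal, Matrix.det_diagonal] at h1
  refine ⟨c.det, ?_⟩
  rw [Matrix.charpoly, Matrix.charmatrix]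
  simpa [a, b, Matrix.algebraMap_eq_diagonal, Pi.algebraMap_def] using h1

variable {n : ℕ}

/-- Every irreducible factor `f` of the characteristic polynomial divides the minimal polynomial
`f g`, and the image of `g(T)` is nonzero and killed by `f(T)`. -/
theorem ker_aeval_ne_bot (T : (Fin n → F) →ₗ[F] (Fin n → F)) {f : F[X]} (hf : Irreducible f)
    (hdvd : f ∣ T.charpoly) : LinearMap.ker (aeval T f) ≠ ⊥ := by
  have h1 : f ∣ minpoly F T := by
    have h2 := charpoly_dvd_minpoly_pow (LinearMap.toMatrix' T)
    rw [LinearMap.minpoly_toMatrix', ← LinearMap.toMatrix_eq_toMatrix',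
      LinearMap.charpoly_toMatrix] at h2
    exact hf.prime.dvd_of_dvd_pow (hdvd.trans h2)
  obtain ⟨g, hg⟩ := h1
  have hm := minpoly.ne_zero (LinearMap.isIntegral T)
  have hg0 : g ≠ 0 := by
    rintro rfl
    exact hm (by rw [hg, mul_zero])
  have hgT : aeval T g ≠ 0 := by
    intro h2
    have h3 := minpoly.degree_le_of_ne_zero F T hg0 h2
    rw [hg, degree_mul] at h3
    have h4 := hf.natDegree_pos
    rw [degree_eq_natDegree hf.ne_zero, degree_eq_natDegree hg0] at h3
    norm_cast at h3
    omega
  intro hbot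
  refine hgT (LinearMap.ext fun v => ?_)
  have h2 : aeval T g v ∈ LinearMap.ker (aeval T f) := by
    rw [LinearMap.mem_ker, ← Module.End.mul_apply, ← map_mul, ← hg, minpoly.aeval]
    rfl
  rw [hbot, Submodule.mem_bot] at h2
  exact h2

end Charpoly

section Decomposition

variable {F E : Type*} [Field F] [AddCommGroup E] [Module F E]

theorem aeval_mem_of_invariant {T : E →ₗ[F] E} {U : Submodule F E} (hU : U.map T ≤ U) (p : F[X])
    {u : E} (hu : u ∈ U) : aeval T p u ∈ U := by
  induction p using Polynomial.induction_on' with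
  | add p r hp hr => rw [map_add]; exact U.add_mem hp hr
  | monomial k r =>
    rw [aeval_monomial, Module.End.mul_apply, Module.algebraMap_end_apply]
    refine U.smul_mem r ?_
    induction k with
    | zero => exact hu
    | succ k ih =>
      rw [pow_succ', Module.End.mul_apply]
      exact hU (Submodule.mem_map_of_mem ih)

/-- An invariant subspace that contains a nonzero vector killed by `f(T)`, where `f` is irreducible,
has dimension at least `deg f`, since the vectors `T ^ k v`, `k < deg f`, are linearly
independent. -/
theorem natDegree_le_finrank [FiniteDimensional F E] {T : E →ₗ[F] E} {f : F[X]}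
    (hf : Irreducible f) {U : Submodule F E} (hU : U.map T ≤ U) {v : E} (hv : v ∈ U)
    (hv0 : v ≠ 0) (hfv : aeval T f v = 0) : f.natDegree ≤ finrank F U := by
  let g : degreeLT F f.natDegree →ₗ[F] U :=
    { toFun := fun p => ⟨aeval T (p : F[X]) v, aeval_mem_of_invariant hU _ hv⟩
      map_add' := fun p r => by ext; simp
      map_smul' := fun c p => by ext; simp }
  have hg : Injective g := by
    rw [injective_iff_map_eq_zero]
    rintro ⟨p, hp⟩ hgp
    have hpv : aeval T p v = 0 := congrArg Subtype.val hgp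
    rw [mem_degreeLT] at hp
    ext1
    simp only [ZeroMemClass.coe_zero]
    by_contra hp0
    have hnd : ¬ f ∣ p := fun hd => by
      have := degree_le_of_dvd hd hp0
      rw [degree_eq_natDegree hf.ne_zero] at this
      exact absurd hp this.not_gt
    obtain ⟨a, b, hab⟩ := (hf.coprime_iff_not_dvd.2 hnd)
    apply hv0
    have h1 := congrArg (fun r => aeval T r v) hab
    simpa [hpv, hfv] using h1.symm
  have h1 := LinearMap.finrank_le_finrank_of_injective hg
  rwa [(degreeLTEquiv F f.natDegree).finrank_eq, finrank_fin_fun] at h1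

theorem iSup_ker_aeval_eq (T : E →ₗ[F] E) {s : Finset F[X]}
    (hs : (s : Set F[X]).Pairwise IsCoprime) :
    ⨆ f ∈ s, LinearMap.ker (aeval T f) = LinearMap.ker (aeval T (∏ f ∈ s, f)) := by
  classical
  induction s using Finset.induction_on with
  | empty => simp [Module.End.one_eq_id]
  | insert f s hfs ih =>
    have hcop : IsCoprime f (∏ g ∈ s, g) := IsCoprime.prod_right fun g hg =>
      hs (by simp) (by simp [hg]) (by rintro rfl; exact hfs hg)
    rw [Finset.iSup_insert, Finset.prod_insert hfs,
      ih (hs.mono (by simp)), sup_ker_aeval_eq_ker_aeval_mul_of_coprime T hcop]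

theorem finrank_iSup_ker_aeval [FiniteDimensional F E] (T : E →ₗ[F] E) {s : Finset F[X]}
    (hs : (s : Set F[X]).Pairwise IsCoprime) :
    finrank F ↥(⨆ f ∈ s, LinearMap.ker (aeval T f)) =
      ∑ f ∈ s, finrank F (LinearMap.ker (aeval T f)) := by
  classical
  induction s using Finset.induction_on with
  | empty => simp
  | insert f s hfs ih =>
    have hcop : IsCoprime f (∏ g ∈ s, g) := IsCoprime.prod_right fun g hg =>
      hs (by simp) (by simp [hg]) (by rintro rfl; exact hfs hg)
    have h1 := Submodule.finrank_sup_add_finrank_inf_eq (LinearMap.ker (aeval T f))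
      (⨆ f ∈ s, LinearMap.ker (aeval T f))
    have h2 : LinearMap.ker (aeval T f) ⊓ (⨆ f ∈ s, LinearMap.ker (aeval T f)) = ⊥ := by
      rw [iSup_ker_aeval_eq T (hs.mono (by simp))]
      exact (disjoint_ker_aeval_of_isCoprime T hcop).eq_bot
    rw [h2, finrank_bot, add_zero, ih (hs.mono (by simp))] at h1
    rw [Finset.iSup_insert, Finset.sum_insert hfs, h1]

end Decomposition

variable {F : Type*} [Field F] {n : ℕ}

/-- A family of invariant subspaces `K f` of positive dimensions `δ f` such that the sums of any of
them are direct and every invariant subspace is the sum of those `K f` which it contains. -/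
structure IsInvariantDecomposition {ι : Type*} [Fintype ι] (T : (Fin n → F) →ₗ[F] (Fin n → F))
    (K : ι → Submodule F (Fin n → F)) (δ : ι → ℕ) : Prop where
  map_le : ∀ f, (K f).map T ≤ K f
  pos : ∀ f, 0 < δ f
  finrank_iSup : ∀ s : Finset ι, finrank F ↥(⨆ f ∈ s, K f) = ∑ f ∈ s, δ f
  eq_iSup : ∀ U : Submodule F (Fin n → F), U.map T ≤ U → U = ⨆ f, ⨆ (_ : K f ≤ U), K f

theorem mem_primeFactors_charpoly_iff {T : (Fin n → F) →ₗ[F] (Fin n → F)} {s : Finset F[X]}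
    (hs : ∀ f ∈ s, f.Monic ∧ Irreducible f) (hT : T.charpoly = ∏ f ∈ s, f) [DecidableEq F]
    {f : F[X]} :
    f ∈ UniqueFactorizationMonoid.primeFactors T.charpoly ↔ f ∈ s := by
  rw [UniqueFactorizationMonoid.mem_primeFactors,
    UniqueFactorizationMonoid.mem_normalizedFactors_iff' T.charpoly_monic.ne_zero]
  constructor
  · rintro ⟨hf, hnorm, hdvd⟩
    rw [hT, hf.prime.dvd_finsetProd_iff] at hdvd
    obtain ⟨g, hg, hfg⟩ := hdvd
    have h1 : Associated f g := hf.associated_of_dvd (hs g hg).2 hfg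
    have h2 := normalize_eq_normalize_iff_associated.2 h1
    rw [hnorm, (hs g hg).1.normalize_eq_self] at h2
    rwa [h2]
  · intro hf
    exact ⟨(hs f hf).2, (hs f hf).1.normalize_eq_self, hT ▸ Finset.dvd_prod_of_mem _ hf⟩

/-- The kernels of `f(T)`, where `f` runs over the irreducible factors of the characteristic
polynomial, determine the invariant subspaces of a regular semisimple operator. -/
theorem isInvariantDecomposition_ker {T : (Fin n → F) →ₗ[F] (Fin n → F)} {s : Finset F[X]}
    (hs : ∀ f ∈ s, f.Monic ∧ Irreducible f) (hT : T.charpoly = ∏ f ∈ s, f) :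
    IsInvariantDecomposition T (fun f : s => LinearMap.ker (aeval T (f : F[X])))
      fun f => (f : F[X]).natDegree := by
  classical
  have hcop : (s : Set F[X]).Pairwise IsCoprime := by
    intro f hf g hg hfg
    rw [(hs f hf).2.coprime_iff_not_dvd]
    intro hd
    exact hfg (eq_of_monic_of_associated (hs f hf).1 (hs g hg).1
      ((hs f hf).2.associated_of_dvd (hs g hg).2 hd))
  have hinv : ∀ f : F[X], (LinearMap.ker (aeval T f)).map T ≤ LinearMap.ker (aeval T f) := by
    rintro f _ ⟨v, hv, rfl⟩
    rw [SetLike.mem_coe, LinearMap.mem_ker] at hv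
    have h1 : aeval T f (T v) = aeval T (f * X) v := by
      rw [map_mul, aeval_X, Module.End.mul_apply]
    rw [LinearMap.mem_ker, h1, mul_comm, map_mul, Module.End.mul_apply, hv, map_zero]
  have hge : ∀ f ∈ s, f.natDegree ≤ finrank F (LinearMap.ker (aeval T f)) := by
    intro f hf
    obtain ⟨v, hv, hv0⟩ := Submodule.exists_mem_ne_zero_of_ne_bot
      (ker_aeval_ne_bot T (hs f hf).2 (hT ▸ Finset.dvd_prod_of_mem _ hf))
    exact natDegree_le_finrank (hs f hf).2 (hinv f) hv hv0 (LinearMap.mem_ker.1 hv)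
  have hsum : ∑ f ∈ s, f.natDegree = ∑ f ∈ s, finrank F (LinearMap.ker (aeval T f)) := by
    rw [← finrank_iSup_ker_aeval T hcop, iSup_ker_aeval_eq T hcop, ← hT,
      LinearMap.aeval_self_charpoly, LinearMap.ker_zero, finrank_top,
      ← natDegree_prod_of_monic _ _ fun f hf => (hs f hf).1, ← hT, LinearMap.charpoly_natDegree]
  have heq : ∀ f ∈ s, f.natDegree = finrank F (LinearMap.ker (aeval T f)) :=
    (Finset.sum_eq_sum_iff_of_le hge).1 hsum
  -- Each kernel is a minimal invariant subspace.
  have hle : ∀ f ∈ s, ∀ U : Submodule F (Fin n → F), U.map T ≤ U → ∀ v ∈ U, v ≠ 0 →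
      aeval T f v = 0 → LinearMap.ker (aeval T f) ≤ U := by
    intro f hf U hU v hv hv0 hfv
    have h1 := natDegree_le_finrank (hs f hf).2 (U := U ⊓ LinearMap.ker (aeval T f))
      ((Submodule.map_inf_le T).trans (inf_le_inf hU (hinv f))) ⟨hv, hfv⟩ hv0 hfv
    rw [heq f hf] at h1
    exact inf_eq_right.1 (Submodule.eq_of_le_of_finrank_le inf_le_right h1)
  have hmem : ∀ U : Submodule F (Fin n → F), U.map T ≤ U → ∀ t ⊆ s, ∀ u ∈ U,
      aeval T (∏ f ∈ t, f) u = 0 →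
      u ∈ ⨆ f : s, ⨆ (_ : LinearMap.ker (aeval T (f : F[X])) ≤ U),
        LinearMap.ker (aeval T (f : F[X])) := by
    intro U hU t
    induction t using Finset.induction_on with
    | empty =>
      intro _ u _ h1
      have : u = 0 := by simpa using h1
      rw [this]
      exact Submodule.zero_mem _
    | insert f t hft ih =>
      intro hts u hu h1
      have hfs : f ∈ s := hts (Finset.mem_insert_self f t)
      have hc : IsCoprime f (∏ g ∈ t, g) := IsCoprime.prod_right fun g hg =>
        hcop hfs (hts (Finset.mem_insert_of_mem hg)) (by rintro rfl; exact hft hg)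
      obtain ⟨a, b, hab⟩ := hc
      rw [Finset.prod_insert hft] at h1
      have h2 : u = aeval T (a * f) u + aeval T (b * ∏ g ∈ t, g) u := by
        rw [← LinearMap.add_apply, ← map_add, hab, map_one, Module.End.one_apply]
      rw [h2]
      refine Submodule.add_mem _ ?_ ?_
      · refine ih ((Finset.subset_insert f t).trans hts) _ (aeval_mem_of_invariant hU _ hu) ?_
        rw [← Module.End.mul_apply, ← map_mul,
          show (∏ g ∈ t, g) * (a * f) = a * (f * ∏ g ∈ t, g) by ring, map_mul,
          Module.End.mul_apply, h1, map_zero]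
      · have h3 : aeval T f (aeval T (b * ∏ g ∈ t, g) u) = 0 := by
          rw [← Module.End.mul_apply, ← map_mul,
            show f * (b * ∏ g ∈ t, g) = b * (f * ∏ g ∈ t, g) by ring, map_mul,
            Module.End.mul_apply, h1, map_zero]
        by_cases h4 : aeval T (b * ∏ g ∈ t, g) u = 0
        · rw [h4]
          exact Submodule.zero_mem _
        · have h5 := hle f hfs U hU _ (aeval_mem_of_invariant hU _ hu) h4 h3
          exact Submodule.mem_iSup_of_mem ⟨f, hfs⟩ (Submodule.mem_iSup_of_mem h5 h3)
  refine ⟨fun f => hinv f, fun f => (hs f f.2).2.natDegree_pos, fun t => ?_, fun U hU => ?_⟩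
  · have h1 := finrank_iSup_ker_aeval T (s := t.map (Embedding.subtype _))
      (hcop.mono fun f hf => by
        rw [Finset.mem_coe, Finset.mem_map] at hf
        obtain ⟨g, _, rfl⟩ := hf
        exact g.2)
    rw [Finset.sum_map, Finset.sup_eq_iSup _ _ |>.symm, Finset.sup_map] at h1
    rw [← Finset.sup_eq_iSup]
    exact h1.trans (Finset.sum_congr rfl fun f _ => (heq f f.2).symm)
  · refine le_antisymm (fun u hu => hmem U hU s subset_rfl u hu ?_)
      (iSup₂_le fun f hf => hf)
    rw [← hT, LinearMap.aeval_self_charpoly, LinearMap.zero_apply]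

end Hessenberg

/-! ### Hessenberg varieties of idempotent Hessenberg functions -/

namespace Hessenberg

open Function Module
open scoped Finset

variable {F : Type*} [Field F] {n : ℕ} {h : ℕ → ℕ} {ι : Type*} [Fintype ι] {δ : ι → ℕ}

/-- The ways of distributing objects of sizes `δ f` to the values `e` of `h` such that the total
size at `e` is the number of arguments where `h` has the value `e`. -/
def distributions (n : ℕ) (h : ℕ → ℕ) (δ : ι → ℕ) : Set (ι → ℕ) :=
  {φ | ∑ f, Finsupp.single (φ f) (δ f) = ∑ i : Fin n, Finsupp.single (h i) 1}

theorem sum_range_sum_single (φ δ : ι → ℕ) (e : ℕ) :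
    ∑ c ∈ Finset.range (e + 1), (∑ f, Finsupp.single (φ f) (δ f)) c = ∑ f with φ f ≤ e, δ f := by
  simp only [Finsupp.finsetSum_apply]
  rw [Finset.sum_comm, Finset.sum_filter]
  refine Finset.sum_congr rfl fun f _ => ?_
  simp [Finsupp.single_apply]

theorem card_filter_le (hh : IsHess n h) {e : ℕ} (he : e < n) (hid : h e = e) :
    ∑ c ∈ Finset.range (e + 1), (∑ i : Fin n, Finsupp.single (h i) 1) c = e + 1 := by
  rw [sum_range_sum_single (fun i : Fin n => h i) (fun _ => 1), ← Finset.card_eq_sum_ones]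
  have h1 : ({i : Fin n | h i ≤ e} : Finset (Fin n)) = Finset.Iic ⟨e, he⟩ := by
    ext i
    simp only [Finset.mem_filter, Finset.mem_univ, true_and, Finset.mem_Iic, Fin.le_def]
    refine ⟨fun h1 => (hh.1 i i.2).1.trans h1, fun h1 => ?_⟩
    have := hh.2 i e h1 he
    rwa [hid] at this
  rw [h1, Fin.card_Iic]

theorem sum_single_eq_zero (hh : IsHess n h) (hid : ∀ i < n, h (h i) = h i) {e : ℕ}
    (he : ¬ (e < n ∧ h e = e)) : (∑ i : Fin n, Finsupp.single (h i) 1) e = 0 := by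
  rw [Finsupp.finsetSum_apply]
  refine Finset.sum_eq_zero fun i _ => Finsupp.single_eq_of_ne ?_
  rintro rfl
  exact he ⟨(hh.1 i i.2).2, hid i i.2⟩

theorem apply_of_mem_distributions (hh : IsHess n h) (hid : ∀ i < n, h (h i) = h i)
    (hδ : ∀ f, 0 < δ f) {φ : ι → ℕ} (hφ : φ ∈ distributions n h δ) (f : ι) :
    φ f < n ∧ h (φ f) = φ f := by
  by_contra hc
  have h1 := sum_single_eq_zero hh hid hc
  have h2 := Finset.single_le_sum (f := fun g => (Finsupp.single (φ g) (δ g) : ℕ →₀ ℕ) (φ f))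
    (fun _ _ => Nat.zero_le _) (Finset.mem_univ f)
  rw [← Finsupp.finsetSum_apply, show ∑ f, Finsupp.single (φ f) (δ f) = _ from hφ, h1] at h2
  have := hδ f
  simp at h2
  omega

theorem finite_distributions (hh : IsHess n h) (hid : ∀ i < n, h (h i) = h i)
    (hδ : ∀ f, 0 < δ f) : (distributions n h δ).Finite :=
  (Set.Finite.pi' fun _ : ι => Set.finite_lt_nat n).subset fun _ hφ f =>
    (apply_of_mem_distributions hh hid hδ hφ f).1

namespace IsInvariantDecomposition

variable {T : (Fin n → F) →ₗ[F] (Fin n → F)} {K : ι → Submodule F (Fin n → F)}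

theorem le_iSup_iff (hK : IsInvariantDecomposition T K δ) (f : ι) (s : Finset ι) :
    K f ≤ ⨆ g ∈ s, K g ↔ f ∈ s := by
  classical
  refine ⟨fun h1 => ?_, fun h1 => le_iSup₂_of_le f h1 le_rfl⟩
  by_contra hf
  have h2 := hK.finrank_iSup (insert f s)
  rw [Finset.iSup_insert, sup_eq_right.2 h1, hK.finrank_iSup, Finset.sum_insert hf] at h2
  have := hK.pos f
  omega

theorem eq_iSup_filter (hK : IsInvariantDecomposition T K δ) {U : Submodule F (Fin n → F)}
    (hU : U.map T ≤ U) {s : Finset ι} (hs : ∀ f, f ∈ s ↔ K f ≤ U) : U = ⨆ f ∈ s, K f := by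
  conv_lhs => rw [hK.eq_iSup U hU]
  simp only [hs]

/-- The least index `e`, among the indices that are fixed by `h`, such that `K f` is contained in
the member `V e` of a flag. -/
noncomputable def position (h : ℕ → ℕ) (K : ι → Submodule F (Fin n → F))
    (V : Fin n → Submodule F (Fin n → F)) (f : ι) : ℕ :=
  sInf {e | h e = e ∧ ∃ he : e < n, K f ≤ V ⟨e, he⟩}

theorem position_spec (hh : IsHess n h) (hK : IsInvariantDecomposition T K δ)
    {V : Fin n → Submodule F (Fin n → F)} (hV : IsFlag V) (f : ι) :
    h (position h K V f) = position h K V f ∧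
      ∃ he : position h K V f < n, K f ≤ V ⟨position h K V f, he⟩ := by
  refine Nat.sInf_mem (s := {e | h e = e ∧ ∃ he : e < n, K f ≤ V ⟨e, he⟩}) ?_
  have hn : 0 < n := by
    have h1 := hK.finrank_iSup {f}
    have h2 := Submodule.finrank_le (⨆ g ∈ ({f} : Finset ι), K g)
    rw [h1, Finset.sum_singleton, finrank_fin_fun] at h2
    exact (hK.pos f).trans_le h2
  have hn1 := hh.1 (n - 1) (by omega)
  refine ⟨n - 1, by omega, by omega, ?_⟩
  have h3 : V ⟨n - 1, by omega⟩ = ⊤ := by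
    refine Submodule.eq_top_of_finrank_eq ?_
    rw [hV.2, finrank_fin_fun]
    simp only
    omega
  rw [h3]
  exact le_top

theorem le_iff_position_le (hh : IsHess n h) (hK : IsInvariantDecomposition T K δ)
    {V : Fin n → Submodule F (Fin n → F)} (hV : IsFlag V) (f : ι) {e : Fin n} (he : h e = e) :
    K f ≤ V e ↔ position h K V f ≤ e := by
  constructor
  · intro h1
    exact Nat.sInf_le ⟨he, e.2, h1⟩
  · intro h1
    obtain ⟨_, h2, h3⟩ := position_spec hh hK hV f
    exact h3.trans (hV.1 (by rw [Fin.le_def]; exact h1))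

theorem map_le_of_mem_points {V : Fin n → Submodule F (Fin n → F)} (hV : V ∈ points T h)
    {e : Fin n} (he : h e = e) : (V e).map T ≤ V e :=
  hV.2 e e he

/-- If `e` is fixed by `h`, then the dimension `e + 1` of `V e` is the total dimension of the `K f`
which it contains, since `V e` is invariant. -/
theorem position_mem_distributions (hh : IsHess n h) (hid : ∀ i < n, h (h i) = h i)
    (hK : IsInvariantDecomposition T K δ) {V : Fin n → Submodule F (Fin n → F)}
    (hV : V ∈ points T h) : position h K V ∈ distributions n h δ := by
  classical
  rw [distributions, Set.mem_ofPred_eq]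
  ext e
  -- The partial sums agree at the fixed points of `h`, and elsewhere both sides vanish.
  induction e using Nat.strong_induction_on with
  | _ e ih =>
  by_cases he : e < n ∧ h e = e
  · have h1 := card_filter_le hh he.1 he.2
    have h2 : ∑ c ∈ Finset.range (e + 1),
        (∑ f, Finsupp.single (position h K V f) (δ f)) c = e + 1 := by
      rw [sum_range_sum_single, ← hK.finrank_iSup, ← hK.eq_iSup_filter (U := V ⟨e, he.1⟩)
        (map_le_of_mem_points hV he.2), hV.1.2]
      intro f
      rw [le_iff_position_le hh hK hV.1 f (e := ⟨e, he.1⟩) he.2]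
      simp
    rw [Finset.sum_range_succ] at h1 h2
    rw [Finset.sum_congr rfl fun c (hc : c ∈ Finset.range e) =>
      ih c (Finset.mem_range.1 hc)] at h2
    exact Nat.add_left_cancel (h2.trans h1.symm)
  · rw [sum_single_eq_zero hh hid he, Finsupp.finsetSum_apply]
    refine Finset.sum_eq_zero fun f _ => Finsupp.single_eq_of_ne ?_
    rintro rfl
    obtain ⟨h1, h2, _⟩ := position_spec hh hK hV.1 f
    exact he ⟨h2, h1⟩

/-- The number of points of the Hessenberg variety of an idempotent Hessenberg function: a point is
a distribution of the minimal invariant subspaces `K f`, which determines the invariant members of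
the flag, together with a choice of the other members. -/
theorem ncard_points [Fintype F] (hh : IsHess n h) (hid : ∀ i < n, h (h i) = h i)
    (hK : IsInvariantDecomposition T K δ) :
    ((points T h).ncard : ℚ) =
      (∏ i : Fin n, qInterval (Fintype.card F) h i) * (distributions n h δ).ncard := by
  classical
  obtain ⟨c, hc⟩ : ∃ c : ℕ, (c : ℚ) = ∏ i : Fin n, qInterval (Fintype.card F) h i :=
    ⟨∏ i : Fin n, ∑ t ∈ Finset.range (h i + 1 - i), Fintype.card F ^ t, by
      simp [qInterval]⟩
  rw [← hc, mul_comm, ncard_eq_mul_of_fibers (finite_distributions hh hid hK.pos)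
    (f := position h K) (fun V hV => position_mem_distributions hh hid hK hV) (c := c),
    Nat.cast_mul]
  intro φ hφ
  have hφe := apply_of_mem_distributions hh hid hK.pos hφ
  have hflag := ncard_flags_of_chain hh hid (fun e => ⨆ f ∈ ({f | φ f ≤ e} : Finset ι), K f)
    (fun e he hee => by
      rw [hK.finrank_iSup, ← sum_range_sum_single,
        show ∑ f, Finsupp.single (φ f) (δ f) = _ from hφ, card_filter_le hh he hee])
    (fun i j hij hj => biSup_mono fun f hf => by
      simp only [Finset.mem_filter, Finset.mem_univ, true_and] at hf ⊢
      exact hf.trans (hh.2 i j hij hj))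
  rw [← hc] at hflag
  rw [← Nat.cast_inj (R := ℚ), ← hflag]
  congr 2
  ext V
  constructor
  · rintro ⟨hV, rfl⟩
    refine ⟨hV.1, fun e he => hK.eq_iSup_filter (map_le_of_mem_points hV he) fun f => ?_⟩
    rw [le_iff_position_le hh hK hV.1 f he]
    simp
  · rintro ⟨hV, hVW⟩
    refine ⟨⟨hV, fun i k hik => ?_⟩, funext fun f => ?_⟩
    · have hk : h k = k := by rw [← hik]; exact hid i i.2
      refine (Submodule.map_mono (hV.1 (show i ≤ k from ?_))).trans (?_ : (V k).map T ≤ V k)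
      · rw [Fin.le_def, ← hik]
        exact (hh.1 i i.2).1
      · rw [hVW k hk, Submodule.map_iSup]
        refine iSup_mono fun f => ?_
        rw [Submodule.map_iSup]
        exact iSup_mono fun _ => hK.map_le f
    · have key : ∀ e < n, h e = e → (position h K V f ≤ e ↔ φ f ≤ e) := by
        intro e he hee
        have h1 := le_iff_position_le hh hK hV f (e := ⟨e, he⟩) hee
        rw [← h1, hVW ⟨e, he⟩ hee, hK.le_iSup_iff]
        simp
      obtain ⟨h1, h2, _⟩ := position_spec hh hK hV f
      exact le_antisymm ((key _ (hφe f).1 (hφe f).2).2 le_rfl) ((key _ h2 h1).1 le_rfl)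

end IsInvariantDecomposition

end Hessenberg

/-! ### Hall products with complete homogeneous and power sum symmetric functions -/

namespace SymFun

open MvPowerSeries
open scoped Finset

variable {R : Type*} [CommRing R]

/-- Two monomials whose nonzero exponents agree as multisets have the same coefficient in a
symmetric function. -/
theorem coeff_eq_of_card_filter_eq {f : MvPowerSeries ℕ R} (hf : f ∈ Sym R) {d d' : ℕ →₀ ℕ}
    (hd : ∀ v ≠ 0, #{i ∈ d.support | d i = v} = #{i ∈ d'.support | d' i = v}) :
    coeff d f = coeff d' f := by
  classical
  have hcard : ∀ (c : ℕ →₀ ℕ) (v : ℕ),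
      Fintype.card {i : c.support // c i = v} = #{i ∈ c.support | c i = v} := by
    intro c v
    rw [Fintype.card_subtype]
    refine Finset.card_bij (fun i _ => i) ?_ ?_ ?_
    · intro i hi
      simpa using hi
    · intro i _ j _ hij
      exact Subtype.ext hij
    · intro i hi
      rw [Finset.mem_filter] at hi
      exact ⟨⟨i, hi.1⟩, by simpa using hi.2, rfl⟩
  have hfib : ∀ v, Fintype.card {i : d.support // d i = v} =
      Fintype.card {i : d'.support // d' i = v} := by
    intro v
    rw [hcard, hcard]
    by_cases hv : v = 0
    · subst hv
      have h0 : ∀ c : ℕ →₀ ℕ, #{i ∈ c.support | c i = 0} = 0 := fun c => by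
        simp [Finset.filter_eq_empty_iff]
      rw [h0, h0]
    · exact hd v hv
  let g : {x // x ∈ d.support} ≃ {x // x ∈ d'.support} :=
    Equiv.ofFiberEquiv (f := fun i : d.support => d i) (g := fun i : d'.support => d' i)
      fun v => Fintype.equivOfCardEq (hfib v)
  have hg : ∀ i, d' (g i) = d i := fun i =>
    Equiv.ofFiberEquiv_map (f := fun i : d.support => d i) (g := fun i : d'.support => d' i)
      (fun v => Fintype.equivOfCardEq (hfib v)) i
  rw [← coeff_embDomain_of_mem hf g.extendSubtype d]
  congr 2
  ext j
  obtain ⟨i, rfl⟩ := g.extendSubtype.surjective j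
  refine (Finsupp.embDomain_apply_self g.extendSubtype.toEmbedding d i).trans ?_
  by_cases hi : i ∈ d.support
  · rw [g.extendSubtype_apply_of_mem i hi, hg]
  · rw [Finsupp.notMem_support_iff.1 hi,
      Finsupp.notMem_support_iff.1 (g.extendSubtype_not_mem i hi)]

theorem card_filter_toFinsupp (l : List ℕ) {v : ℕ} (hv : v ≠ 0) :
    #{i ∈ l.toFinsupp.support | l.toFinsupp i = v} = l.count v := by
  have h1 : ({i ∈ l.toFinsupp.support | l.toFinsupp i = v} : Finset ℕ) =
      {i ∈ Finset.range l.length | l.getD i 0 = v} := by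
    ext i
    rw [Finset.mem_filter, Finset.mem_filter, Finsupp.mem_support_iff, Finset.mem_range,
      List.toFinsupp_apply]
    refine and_congr_left fun h2 => ⟨fun h3 => ?_, fun _ => h2 ▸ hv⟩
    by_contra h4
    exact h3 (List.getD_eq_default _ _ (not_lt.1 h4))
  rw [h1, Finset.card_filter]
  clear h1
  induction l with
  | nil => simp
  | cons a l ih =>
    rw [List.length_cons, Finset.sum_range_succ', List.count_cons, ← ih]
    simp

theorem card_filter_expo (μ : ℕ+ →₀ ℕ) (v : ℕ+) :
    #{i ∈ (expo μ).support | expo μ i = v} = μ v := by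
  rw [expo, card_filter_toFinsupp _ v.ne_zero, ← Multiset.coe_count, Multiset.sort_eq,
    Multiset.count_map_eq_count' _ _ PNat.coe_injective, Finsupp.count_toMultiset]

/-- The Hall product of `f` with `h_{d₁} h_{d₂} ⋯` is the coefficient of `x₁^{d₁} x₂^{d₂} ⋯` in
`f`, also when the exponents `dᵢ` are not in decreasing order. -/
theorem hall_prod_h (f : Sym R) (d : ℕ →₀ ℕ) :
    hall R f (d.prod fun _ k => h R k) = coeff d (f : MvPowerSeries ℕ R) := by
  classical
  have hpos : ∀ i ∈ d.support, ((d i).toPNat' : ℕ) = d i := fun i hi => by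
    rw [Nat.toPNat'_coe, if_pos (Nat.pos_of_ne_zero (Finsupp.mem_support_iff.1 hi))]
  have h1 : (d.prod fun _ k => h R k) =
      hBasis R (∑ i ∈ d.support, Finsupp.single (d i).toPNat' 1) := by
    rw [hBasis_apply, ← Finsupp.prod_finsetSum_index (fun _ => pow_zero _)
      (fun _ _ _ => pow_add _ _ _), Finsupp.prod]
    refine Finset.prod_congr rfl fun i hi => ?_
    rw [Finsupp.prod_single_index (h := fun (k : ℕ+) a => h R k ^ a) (pow_zero _), pow_one,
      hpos i hi]
  rw [h1, hall_hBasis]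
  refine coeff_eq_of_card_filter_eq f.2 fun v hv => ?_
  obtain ⟨v, rfl⟩ : ∃ w : ℕ+, (w : ℕ) = v := ⟨⟨v, Nat.pos_of_ne_zero hv⟩, rfl⟩
  rw [card_filter_expo, Finsupp.finsetSum_apply, Finset.card_filter]
  refine Finset.sum_congr rfl fun i hi => ?_
  rw [Finsupp.single_apply]
  refine if_congr ?_ rfl rfl
  rw [← PNat.coe_inj, hpos i hi]

open Classical in
theorem coeff_p (k : ℕ) (d : ℕ →₀ ℕ) :
    coeff d (p R k : MvPowerSeries ℕ R) = if ∃ i, d = Finsupp.single i k then 1 else 0 := rfl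

/-- The coefficient of a monomial in a product of power sums counts the ways to distribute the
factors to the variables. -/
theorem coeff_prod_p {ι : Type*} [Fintype ι] {δ : ι → ℕ} (hδ : ∀ f, 0 < δ f) (d : ℕ →₀ ℕ) :
    coeff d ((∏ f, p R (δ f) : Sym R) : MvPowerSeries ℕ R) =
      ({φ : ι → ℕ | ∑ f, Finsupp.single (φ f) (δ f) = d}.ncard : R) := by
  classical
  rw [SubmonoidClass.coe_finsetProd, MvPowerSeries.coeff_prod]
  simp only [coeff_p, Finset.prod_boole, Finset.mem_univ, true_imp_iff]
  rw [Finset.sum_boole, ← Set.ncard_coe_finset]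
  congr 1
  let S : (ι → ℕ) → ι →₀ ℕ →₀ ℕ := fun φ =>
    Finsupp.equivFunOnFinite.symm fun f => Finsupp.single (φ f) (δ f)
  have hS : S.Injective := by
    intro φ ψ hφψ
    funext f
    have h1 : Finsupp.single (φ f) (δ f) = Finsupp.single (ψ f) (δ f) := DFunLike.congr_fun hφψ f
    exact Finsupp.single_left_injective (hδ f).ne' h1
  rw [← Set.ncard_image_of_injective _ hS]
  congr 1
  ext l
  simp only [Finset.coe_filter, Finset.mem_finsuppAntidiag, Finset.subset_univ, and_true,
    Set.mem_ofPred_eq, Set.mem_image]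
  constructor
  · rintro ⟨h1, h2⟩
    choose φ hφ using h2
    refine ⟨φ, ?_, ?_⟩
    · rw [← h1]
      exact Finset.sum_congr rfl fun f _ => (hφ f).symm
    · ext1 f
      exact (hφ f).symm
  · rintro ⟨φ, h1, rfl⟩
    exact ⟨h1, fun f => ⟨φ f, rfl⟩⟩

end SymFun

namespace Hessenberg

open Module
open scoped Finset

variable {F : Type*} [Field F] {n : ℕ} {h : ℕ → ℕ}

theorem prod_blockSize (hh : IsHess n h) :
    ∏ e : Fin n, SymFun.h ℚ (blockSize n h e) =
      (∑ i : Fin n, Finsupp.single (h i) 1).prod fun _ k => SymFun.h ℚ k := by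
  classical
  have h1 : ∀ e, (∑ i : Fin n, Finsupp.single (h i) 1 : ℕ →₀ ℕ) e = blockSize n h e := by
    intro e
    rw [Finsupp.finsetSum_apply, blockSize, Finset.card_filter]
    exact Finset.sum_congr rfl fun i _ => by rw [Finsupp.single_apply]
  rw [Finsupp.prod_of_support_subset _ (s := Finset.range n) _ _ fun _ _ => SymFun.h_zero,
    Finset.prod_range]
  · exact Finset.prod_congr rfl fun e _ => by rw [h1]
  · intro e he
    rw [Finsupp.mem_support_iff, h1, blockSize, ← Nat.pos_iff_ne_zero, Finset.card_pos] at he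
    obtain ⟨i, hi⟩ := he
    rw [Finset.mem_range, ← (Finset.mem_filter.1 hi).2]
    exact (hh.1 i i.2).2

theorem pProd_degrees {T : (Fin n → F) →ₗ[F] (Fin n → F)} {s : Finset (Polynomial F)}
    (hs : ∀ f ∈ s, f.Monic ∧ Irreducible f) (hT : T.charpoly = ∏ f ∈ s, f) :
    SymFun.pProd ℚ (degrees T) = ∏ f : s, SymFun.p ℚ (f : Polynomial F).natDegree := by
  classical
  have h1 : UniqueFactorizationMonoid.primeFactors T.charpoly = s := by
    ext f
    exact mem_primeFactors_charpoly_iff hs hT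
  rw [SymFun.pProd, degrees, h1, Multiset.map_map, Finset.prod_coe_sort s
    fun f => SymFun.p ℚ f.natDegree]
  rfl

/-! ### The number of points of a regular semisimple Hessenberg variety -/

/-- Chromatic quasisymmetric functions of indifference graphs are symmetric: modulo the symmetric
functions, they satisfy the modular law and vanish for idempotent Hessenberg functions. -/
theorem chromaticSum_mem {q : ℚ} (hq : 0 < q) (hh : IsHess n h) :
    chromaticSum n q h ∈ SymFun.Sym ℚ := by
  let S : Submodule ℚ (MvPowerSeries ℕ ℚ) := Subalgebra.toSubmodule (SymFun.Sym ℚ)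
  have hmod := isModular_chromaticSum n q
  have h1 : IsModular n q fun h => S.mkQ (chromaticSum n q h) := by
    refine ⟨fun h i j a b c d e f g => ?_, fun h i c a b d e f => ?_⟩
    · rw [← map_smul, hmod.row h i j a b c d e f g, map_add, map_smul]
    · rw [← map_smul, hmod.col h i c a b d e f, map_add, map_smul]
  have h2 := h1.eq_zero hq (fun h hh hid => by
    rw [chromaticSum_of_idempotent hh hid q]
    exact (Submodule.Quotient.mk_eq_zero S).2 (Subtype.property _)) h hh
  exact (Submodule.Quotient.mk_eq_zero S).1 h2

/-- Both sides satisfy the modular law once the linear form `f ↦ ⟨p_λ, ω f⟩` is extended to all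
power series, so it suffices to compare them for idempotent Hessenberg functions. There, both are the
same multiple of the number of distributions of the irreducible factors. -/
theorem ncard_points_eq [Fintype F] {T : (Fin n → F) →ₗ[F] (Fin n → F)}
    (hT : IsRegularSemisimple T) (hh : IsHess n h)
    (hX : chromaticSum n (Fintype.card F) h ∈ SymFun.Sym ℚ) :
    ((points T h).ncard : ℚ) = SymFun.hall ℚ (SymFun.pProd ℚ (degrees T))
      (SymFun.omega ℚ ⟨chromaticSum n (Fintype.card F) h, hX⟩) := by
  obtain ⟨s, hs, hTs⟩ := hT
  have hK := isInvariantDecomposition_ker hs hTs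
  have hq : (0 : ℚ) < Fintype.card F := by exact_mod_cast Fintype.card_pos
  obtain ⟨Ψ, hΨ⟩ := LinearMap.exists_extend (p := Subalgebra.toSubmodule (SymFun.Sym ℚ))
    ((SymFun.hall ℚ (SymFun.pProd ℚ (degrees T))).comp (SymFun.omega ℚ).toLinearMap)
  have hΨ' : ∀ f : SymFun.Sym ℚ, Ψ (f : MvPowerSeries ℕ ℚ) =
      SymFun.hall ℚ (SymFun.pProd ℚ (degrees T)) (SymFun.omega ℚ f) := fun f =>
    LinearMap.congr_fun hΨ f
  rw [← hΨ' ⟨_, hX⟩, ← sub_eq_zero]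
  have hX' := isModular_chromaticSum n (Fintype.card F)
  have hP := isModular_ncard_points T
  have hmod : IsModular n (Fintype.card F) fun h =>
      ((points T h).ncard : ℚ) - Ψ (chromaticSum n (Fintype.card F) h) := by
    refine ⟨fun h i j a b c d e f g => ?_, fun h i c a b d e f => ?_⟩
    · rw [smul_sub, ← map_smul, hX'.row h i j a b c d e f g, hP.row h i j a b c d e f g, map_add,
        map_smul, smul_sub]
      abel
    · rw [smul_sub, ← map_smul, hX'.col h i c a b d e f, hP.col h i c a b d e f, map_add,
        map_smul, smul_sub]
      abel
  refine hmod.eq_zero hq (fun h hh hid => ?_) h hh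
  rw [hK.ncard_points hh hid, chromaticSum_of_idempotent hh hid, hΨ', map_smul, map_prod, map_smul]
  simp only [SymFun.omega_e]
  rw [prod_blockSize hh, SymFun.hall_prod_h, pProd_degrees hs hTs, SymFun.coeff_prod_p hK.pos,
    smul_eq_mul, distributions, sub_self]

end Hessenberg

theorem mainTheorem9 {F : Type*} [Field F] [Fintype F] {n : ℕ} (m : Fin n → Fin n)
    (hm : Hessenberg.IsHessenberg m) (T : (Fin n → F) →ₗ[F] (Fin n → F))
    (hT : Hessenberg.IsRegularSemisimple T) :
    ∃ hX : Hessenberg.chromatic (Hessenberg.graph m) (Fintype.card F : ℚ) ∈ SymFun.Sym ℚ,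
      ((Hessenberg.variety m T).ncard : ℚ) =
        SymFun.hall ℚ (SymFun.pProd ℚ (Hessenberg.degrees T))
          (SymFun.omega ℚ ⟨Hessenberg.chromatic (Hessenberg.graph m) (Fintype.card F : ℚ), hX⟩) := by
  have hq : (0 : ℚ) < Fintype.card F := by exact_mod_cast Fintype.card_pos
  have hh := hm.isHess_extend
  simp only [Hessenberg.chromatic_eq_chromaticSum, Hessenberg.variety_eq_points]
  exact ⟨Hessenberg.chromaticSum_mem hq hh,
    Hessenberg.ncard_points_eq hT hh (Hessenberg.chromaticSum_mem hq hh)⟩
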